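/- Let $p,Q,r,s:\mathbb R\to\mathbb R$ satisfy $$\frac1{\sqrt{|p|}},\ \frac{Q}{\sqrt{|p|}},\ \frac{r}{\sqrt{|p|}}\in L^2_{\mathrm{loc}}(\mathbb R),\qquad s\in L^1_{\mathrm{loc}}(\mathbb R),\qquad \frac1p\neq 0\ \text{ a.e.},$$ and consider the formal expression $l[u]=-(pu')'+qu+i\big((ru)'+ru'\big)$ with $q=Q'+s$ in the sense of distributions. It is understood through the quasi-derivatives $$u^{[1]}:=pu'-(Q+ir)u,\qquad u^{[2]}:=\big(u^{[1]}\big)'+\frac{Q-ir}{p}\,u^{[1]}+\Big(\frac{Q^2+r^2}{p}-s\Big)u,\qquad l[u]:=-u^{[2]}.$$ In the complex Hilbert space $L^2(\mathbb R)$ let $\mathrm L$ be the maximal operator, $\mathrm Lu:=l[u]$ with $$\mathrm{Dom}(\mathrm L):=\{u\in L^2(\mathbb R)\mid u,u^{[1]}\in \mathrm{AC}_{\mathrm{loc}}(\mathbb R),\ l[u]\in L^2(\mathbb R)\},$$ and let $\mathrm L_{00}$ be the preminimal operator, the restriction of $\mathrm L$ to those $u\in\mathrm{Dom}(\mathrm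 L)$ whose support is compact. Assume in addition that (i) $p\in W^1_{2,\mathrm{loc}}(\mathbb R)$ and (the continuous representative of) $p$ is positive at every point of $\mathbb R$; (ii) $\displaystyle\int_{-\infty}^0 p^{-1/2}(t)\,dt=\int_0^\infty p^{-1/2}(t)\,dt=\infty$. If $\mathrm L_{00}$ is bounded from below, that is, for some $c\in\mathbb R$ one has $(\mathrm L_{00}u,u)\ge c\,(u,u)$ for all $u\in\mathrm{Dom}(\mathrm L_{00})$, then $\mathrm L_{00}$ is essentially self-adjoint (it is densely defined and symmetric, and its closure is self-adjoint), and $\mathrm L_{00}^*=\mathrm L=\mathrm L^*$. -/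

import Mathlib

open MeasureTheory Set Filter
open scoped ContDiff

noncomputable section

namespace SturmLiouville

/-- `f ∈ L²_loc(ℝ)`. -/
def MemL2Loc (f : ℝ → ℝ) : Prop :=
  ∀ K : Set ℝ, IsCompact K → MemLp f 2 (volume.restrict K)

/-- `f ∈ W¹_{2,loc}(ℝ)`: `f` and its weak (distributional) derivative belong to `L²_loc(ℝ)`. -/
def MemW12Loc (f : ℝ → ℝ) : Prop :=
  MemL2Loc f ∧ ∃ g : ℝ → ℝ, MemL2Loc g ∧
    ∀ φ : ℝ → ℝ, ContDiff ℝ ∞ φ → HasCompactSupport φ →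
      ∫ x, f x * deriv φ x = -∫ x, g x * φ x

/-- `u ∈ AC_loc(ℝ)`: absolutely continuous on every compact interval. -/
def ACLoc (u : ℝ → ℂ) : Prop :=
  ∀ a b : ℝ, AbsolutelyContinuousOnInterval u a b

/-- The conditions on the real coefficients `p, Q, r, s` of
`l[u] = -(pu')' + qu + i((ru)' + ru')`, where `q = Q' + s` in the sense of distributions. -/
structure CoeffConditions (p Q r s : ℝ → ℝ) : Prop where
  inv_sqrt : MemL2Loc fun x => 1 / √|p x|
  Q_div_sqrt : MemL2Loc fun x => Q x / √|p x|
  r_div_sqrt : MemL2Loc fun x => r x / √|p x|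
  s_loc : LocallyIntegrable s volume
  inv_ne_zero : ∀ᵐ x : ℝ, 1 / p x ≠ 0

/-- The first quasi-derivative `pu' - (Q + ir)u`, which is defined almost everywhere for
`u ∈ AC_loc`. -/
def quasiDeriv₁ (p Q r : ℝ → ℝ) (u : ℝ → ℂ) (x : ℝ) : ℂ :=
  (p x : ℂ) * deriv u x - ((Q x : ℂ) + Complex.I * (r x : ℂ)) * u x

/-- The second quasi-derivative `v' + ((Q - ir)/p) v + ((Q² + r²)/p - s) u`, where `v` is the
(absolutely continuous) first quasi-derivative of `u`. -/
def quasiDeriv₂ (p Q r s : ℝ → ℝ) (u v : ℝ → ℂ) (x : ℝ) : ℂ :=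
  deriv v x + ((Q x : ℂ) - Complex.I * (r x : ℂ)) / (p x : ℂ) * v x
    + (((Q x : ℂ) ^ 2 + (r x : ℂ) ^ 2) / (p x : ℂ) - (s x : ℂ)) * u x

/-- The Hilbert space `L²(ℝ)` of complex-valued functions. -/
abbrev L2 : Type := Lp ℂ 2 (volume : Measure ℝ)

/-- `f ∈ Dom(L)` and `L f = g`: the class `f` has a representative `u ∈ AC_loc`, its first
quasi-derivative is (a.e. equal to) some `v ∈ AC_loc`, and `g = l[u] = -u^{[2]}` in `L²(ℝ)`. -/
def IsMaximalPair (p Q r s : ℝ → ℝ) (f g : L2) : Prop :=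
  ∃ u v : ℝ → ℂ, ACLoc u ∧ ACLoc v ∧ f =ᵐ[volume] u ∧
    v =ᵐ[volume] quasiDeriv₁ p Q r u ∧
    g =ᵐ[volume] fun x => -quasiDeriv₂ p Q r s u v x

theorem ACLoc.continuous {u : ℝ → ℂ} (hu : ACLoc u) : Continuous u := by
  rw [continuous_iff_continuousAt]
  intro x
  refine (hu (x - 1) (x + 1)).continuousOn.continuousAt ?_
  rw [uIcc_of_le (by linarith)]
  exact Icc_mem_nhds (by linarith) (by linarith)

theorem ACLoc.ae_differentiableAt {u : ℝ → ℂ} (hu : ACLoc u) :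
    ∀ᵐ x : ℝ, DifferentiableAt ℝ u x := by
  have h : ∀ n : ℕ, ∀ᵐ x : ℝ, x ∈ uIcc (-(n : ℝ)) n → DifferentiableAt ℝ u x := fun n =>
    (hu _ _).boundedVariationOn.ae_differentiableAt_of_mem_uIcc
  filter_upwards [ae_all_iff.2 h] with x hx
  obtain ⟨n, hn⟩ := exists_nat_ge |x|
  refine hx n ?_
  rw [uIcc_of_le (by linarith [abs_nonneg x])]
  exact abs_le.1 hn

/-- The graph of the maximal operator. -/
def maximalGraph (p Q r s : ℝ → ℝ) : Submodule ℂ (L2 × L2) where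
  carrier := {z | IsMaximalPair p Q r s z.1 z.2}
  zero_mem' := by
    have h0 : ACLoc (fun _ => (0 : ℂ)) := fun a b =>
      contDiff_const.contDiffOn.absolutelyContinuousOnInterval
    refine ⟨fun _ => 0, fun _ => 0, h0, h0, Lp.coeFn_zero ℂ 2 volume, ?_, ?_⟩
    · exact Eventually.of_forall fun x => by simp [quasiDeriv₁]
    · filter_upwards [Lp.coeFn_zero ℂ 2 (volume : Measure ℝ)] with x _
      simp [quasiDeriv₂]
  add_mem' := by
    rintro ⟨f, g⟩ ⟨f', g'⟩ ⟨u, v, hu, hv, hf, h1, h2⟩ ⟨u', v', hu', hv', hf', h1', h2'⟩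
    refine ⟨u + u', v + v', fun a b => (hu a b).add (hu' a b), fun a b => (hv a b).add (hv' a b),
      (Lp.coeFn_add f f').trans (hf.add hf'), ?_, ?_⟩
    · filter_upwards [h1, h1', hu.ae_differentiableAt, hu'.ae_differentiableAt] with x e e' d d'
      simp only [Pi.add_apply, e, e', quasiDeriv₁, deriv_add d d']
      ring
    · filter_upwards [h2, h2', hv.ae_differentiableAt, hv'.ae_differentiableAt,
        Lp.coeFn_add g g'] with x e e' d d' ea
      simp only [Prod.mk_add_mk, ea, Pi.add_apply, e, e', quasiDeriv₂, deriv_add d d']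
      ring
  smul_mem' := by
    rintro c ⟨f, g⟩ ⟨u, v, hu, hv, hf, h1, h2⟩
    refine ⟨fun x => c • u x, fun x => c • v x, fun a b => (hu a b).const_smul c,
      fun a b => (hv a b).const_smul c, ?_, ?_, ?_⟩
    · filter_upwards [hf, Lp.coeFn_smul c f] with x e ea
      simp only [Prod.smul_mk, ea, Pi.smul_apply, e]
    · filter_upwards [h1, hu.ae_differentiableAt] with x e d
      have hd : deriv (fun x => c • u x) x = c • deriv u x := deriv_fun_const_smul c d
      simp only [quasiDeriv₁, hd, e]
      simp only [smul_eq_mul]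
      ring
    · filter_upwards [h2, hv.ae_differentiableAt, Lp.coeFn_smul c g] with x e d ea
      have hd : deriv (fun x => c • v x) x = c • deriv v x := deriv_fun_const_smul c d
      simp only [Prod.smul_mk, ea, Pi.smul_apply, e, quasiDeriv₂, hd]
      simp only [smul_eq_mul]
      ring

/-- `l[u]` is determined by the class of `u`, so `maximalGraph` is the graph of an operator. -/
theorem maximalGraph_snd_eq_zero (p Q r s : ℝ → ℝ) (z : L2 × L2)
    (hz : z ∈ maximalGraph p Q r s) (h0 : z.1 = 0) : z.2 = 0 := by
  obtain ⟨u, v, hu, hv, hf, h1, h2⟩ := hz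
  rw [h0] at hf
  have hu0 : u = 0 := by
    refine (hu.continuous.ae_eq_iff_eq volume continuous_zero).1 ?_
    exact hf.symm.trans (Lp.coeFn_zero ℂ 2 volume)
  subst hu0
  have hv0 : v = 0 := by
    refine (hv.continuous.ae_eq_iff_eq volume continuous_zero).1 ?_
    filter_upwards [h1] with x e
    rw [e]
    simp [quasiDeriv₁]
  subst hv0
  apply Lp.ext
  filter_upwards [h2, Lp.coeFn_zero ℂ 2 (volume : Measure ℝ)] with x e e0
  rw [e, e0]
  simp [quasiDeriv₂]

/-- The maximal operator `L` in `L²(ℝ)`: `L u = l[u]` on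
`{u ∈ L² | u, u^{[1]} ∈ AC_loc, l[u] ∈ L²}`. -/
def maximalOp (p Q r s : ℝ → ℝ) : L2 →ₗ.[ℂ] L2 :=
  (maximalGraph p Q r s).toLinearPMap

theorem mem_graph_maximalOp (p Q r s : ℝ → ℝ) (f g : L2) :
    (f, g) ∈ (maximalOp p Q r s).graph ↔ IsMaximalPair p Q r s f g := by
  rw [maximalOp, Submodule.toLinearPMap_graph_eq _ (maximalGraph_snd_eq_zero p Q r s)]
  rfl

/-- The classes in `L²(ℝ)` that vanish outside a compact set. (If such a class has a continuous
representative, then that representative has compact support.) -/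
def compactlySupported : Submodule ℂ L2 where
  carrier := {f | ∃ w : ℝ → ℂ, HasCompactSupport w ∧ f =ᵐ[volume] w}
  zero_mem' := ⟨0, HasCompactSupport.zero, Lp.coeFn_zero ℂ 2 volume⟩
  add_mem' := by
    rintro f g ⟨w, hw, hf⟩ ⟨w', hw', hg⟩
    exact ⟨w + w', hw.add hw', (Lp.coeFn_add f g).trans (hf.add hg)⟩
  smul_mem' := by
    rintro c f ⟨w, hw, hf⟩
    refine ⟨fun x => c • w x, hw.smul_left (f := fun _ => c), ?_⟩
    filter_upwards [hf, Lp.coeFn_smul c f] with x e ea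
    simp only [ea, Pi.smul_apply, e]

/-- The preminimal operator `L₀₀`: the restriction of `L` to the functions in `Dom(L)` with
compact support. -/
def preminimalOp (p Q r s : ℝ → ℝ) : L2 →ₗ.[ℂ] L2 :=
  (maximalOp p Q r s).domRestrict compactlySupported

/-- `(T u, u) ≥ c (u, u)` on `Dom(T)` for some real `c`. -/
def BoundedBelow (T : L2 →ₗ.[ℂ] L2) : Prop :=
  ∃ c : ℝ, ∀ u : T.domain, c * ‖(u : L2)‖ ^ 2 ≤ (inner ℂ (T u) (u : L2)).re

/-- A densely defined symmetric operator is essentially self-adjoint if its closure is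
self-adjoint. -/
structure EssentiallySelfAdjoint (T : L2 →ₗ.[ℂ] L2) : Prop where
  dense : Dense (T.domain : Set L2)
  symmetric : T.IsFormalAdjoint T
  closable : T.IsClosable
  closure_selfAdjoint : IsSelfAdjoint T.closure

end SturmLiouville

end

namespace SturmLiouville

section Abstract

open Topology

variable {H : Type*} [NormedAddCommGroup H] [InnerProductSpace ℂ H]

/-- The adjoint relation of `S` does not change when `S` is replaced by its closure. -/
theorem adjoint_topologicalClosure (S : Submodule ℂ (H × H)) :
    S.topologicalClosure.adjoint = S.adjoint := by
  ext x
  rw [Submodule.mem_adjoint_iff, Submodule.mem_adjoint_iff]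
  refine ⟨fun h a b hab => h a b (S.le_topologicalClosure hab), fun h a b hab => ?_⟩
  have hcl : IsClosed {z : H × H | inner ℂ z.2 x.1 - inner ℂ z.1 x.2 = 0} :=
    isClosed_eq (by fun_prop) continuous_const
  exact closure_minimal (fun z hz => h z.1 z.2 hz) hcl hab

variable [CompleteSpace H]

/-- A symmetric operator `T` that is bounded from below by `c`, whose adjoint relation is the graph
of `L`, and such that `L - μ` is injective for some `μ < c`, has closure `L`. -/
theorem graph_topologicalClosure_eq {T L : H →ₗ.[ℂ] H} {c μ : ℝ} (hTL : T ≤ L) (hμ : μ < c)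
    (hL : L.graph = T.graph.adjoint)
    (hbdd : ∀ u : T.domain, c * ‖(u : H)‖ ^ 2 ≤ (inner ℂ (T u) (u : H)).re)
    (hker : ∀ f : H, (f, (μ : ℂ) • f) ∈ L.graph → f = 0) :
    T.graph.topologicalClosure = L.graph := by
  have hTL' : T.graph ≤ L.graph := LinearPMap.le_graph_of_le hTL
  have hclosed : IsClosed (L.graph : Set (H × H)) := by
    have : (L.graph : Set (H × H)) =
        ⋂ z ∈ T.graph, {x : H × H | inner ℂ z.2 x.1 - inner ℂ z.1 x.2 = 0} := by
      ext x
      rw [SetLike.mem_coe, hL, Submodule.mem_adjoint_iff]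
      simp only [mem_iInter, mem_ofPred_eq, Prod.forall]
    rw [this]
    refine isClosed_biInter fun z _ => isClosed_eq ?_ continuous_const
    fun_prop
  refine le_antisymm (Submodule.topologicalClosure_minimal _ hTL' hclosed) ?_
  -- the range of `T - μ`
  let R : Submodule ℂ H := T.graph.map
    (LinearMap.snd ℂ H H - (μ : ℂ) • LinearMap.fst ℂ H H)
  have hR : R.topologicalClosure = ⊤ := by
    rw [Submodule.topologicalClosure_eq_top_iff, Submodule.eq_bot_iff]
    intro f hf
    refine hker f ?_
    rw [hL, Submodule.mem_adjoint_iff]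
    intro a b hab
    have h := (Submodule.mem_orthogonal R f).1 hf (b - (μ : ℂ) • a) ⟨(a, b), hab, by simp⟩
    rw [inner_sub_left, inner_smul_left] at h
    rw [inner_smul_right]
    simpa using h
  rintro ⟨f, g⟩ hfg
  have hmem : g - (μ : ℂ) • f ∈ closure (R : Set H) := by
    have : g - (μ : ℂ) • f ∈ R.topologicalClosure := by rw [hR]; trivial
    exact this
  obtain ⟨y, hyR, hy⟩ := mem_closure_iff_seq_limit.1 hmem
  choose z hzT hz using hyR
  have hlow : ∀ x ∈ T.graph, (c - μ) * ‖x.1‖ ≤ ‖x.2 - (μ : ℂ) • x.1‖ := by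
    rintro ⟨a, b⟩ hab
    obtain ⟨u, rfl, rfl⟩ := (LinearPMap.mem_graph_iff _).1 hab
    have h1 := hbdd u
    have h2 : (inner ℂ (T u - (μ : ℂ) • (u : H)) (u : H)).re
        = (inner ℂ (T u) (u : H)).re - μ * ‖(u : H)‖ ^ 2 := by
      rw [inner_sub_left, inner_smul_left, Complex.sub_re, Complex.conj_ofReal,
        Complex.re_ofReal_mul, inner_self_eq_norm_sq_to_K]
      norm_cast
    have h3 : (inner ℂ (T u - (μ : ℂ) • (u : H)) (u : H)).re
        ≤ ‖T u - (μ : ℂ) • (u : H)‖ * ‖(u : H)‖ := re_inner_le_norm (𝕜 := ℂ) _ _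
    rcases (norm_nonneg (u : H)).eq_or_lt with h0 | h0
    · simp only [← h0]; simp
    · refine le_of_mul_le_mul_right ?_ h0
      nlinarith
  have hz' : ∀ n, (z n).2 - (μ : ℂ) • (z n).1 = y n := fun n => by simpa using hz n
  have hcauchy : CauchySeq fun n => (z n).1 := by
    rw [Metric.cauchySeq_iff']
    intro ε hε
    obtain ⟨N, hN⟩ := Metric.cauchySeq_iff'.1 hy.cauchySeq ((c - μ) * ε)
      (mul_pos (sub_pos.2 hμ) hε)
    refine ⟨N, fun n hn => ?_⟩
    have h := hlow _ (T.graph.sub_mem (hzT n) (hzT N))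
    have h' := hN n hn
    have e : (z n - z N).2 - (μ : ℂ) • (z n - z N).1 = y n - y N := by
      rw [← hz' n, ← hz' N, Prod.snd_sub, Prod.fst_sub, smul_sub]; abel
    rw [e] at h
    rw [dist_eq_norm] at h' ⊢
    exact lt_of_mul_lt_mul_left (h.trans_lt h') (sub_pos.2 hμ).le
  obtain ⟨f', hf'⟩ := cauchySeq_tendsto_of_complete hcauchy
  have hlim : Tendsto z atTop (𝓝 (f', g - (μ : ℂ) • f + (μ : ℂ) • f')) := by
    refine hf'.prodMk_nhds ?_
    have := hy.add (hf'.const_smul (μ : ℂ))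
    refine this.congr fun n => ?_
    rw [← hz' n]; simp
  have hcl : (f', g - (μ : ℂ) • f + (μ : ℂ) • f') ∈ T.graph.topologicalClosure :=
    mem_closure_of_tendsto hlim (Eventually.of_forall hzT)
  have hcl' := Submodule.topologicalClosure_minimal _ hTL' hclosed hcl
  have hf0 : f - f' = 0 := by
    refine hker _ ?_
    have := L.graph.sub_mem hfg hcl'
    convert! this using 1
    rw [Prod.mk_sub_mk, smul_sub]
    congr 1
    abel
  have : f' = f := (sub_eq_zero.1 hf0).symm
  subst this
  simpa using hcl

/-- A semibounded operator `T` with `T ≤ L`, where `L` is the adjoint relation of `T` and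
`L - μ` is injective for some `μ` below the bound, is essentially self-adjoint. -/
theorem essentiallySelfAdjoint_of_ker {T L : H →ₗ.[ℂ] H} {c μ : ℝ} (hTL : T ≤ L) (hμ : μ < c)
    (hL : L.graph = T.graph.adjoint)
    (hbdd : ∀ u : T.domain, c * ‖(u : H)‖ ^ 2 ≤ (inner ℂ (T u) (u : H)).re)
    (hker : ∀ f : H, (f, (μ : ℂ) • f) ∈ L.graph → f = 0) :
    Dense (T.domain : Set H) ∧ T.IsFormalAdjoint T ∧ T.IsClosable ∧ T.closure = L ∧
      T.adjoint = L ∧ L.adjoint = L := by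
  have hcl := graph_topologicalClosure_eq hTL hμ hL hbdd hker
  have hdense : Dense (T.domain : Set H) := by
    have h : T.domain.topologicalClosure = ⊤ := by
      rw [Submodule.topologicalClosure_eq_top_iff, Submodule.eq_bot_iff]
      intro g hg
      have : ((0 : H), g) ∈ L.graph := by
        rw [hL, Submodule.mem_adjoint_iff]
        intro a b hab
        have := (Submodule.mem_orthogonal _ g).1 hg a (LinearPMap.mem_domain_of_mem_graph hab)
        simp [this]
      exact LinearPMap.graph_fst_eq_zero_snd L this rfl
    exact Submodule.dense_iff_topologicalClosure_eq_top.2 h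
  have hclosable : T.IsClosable := ⟨L, hcl⟩
  have hclos : T.closure = L := LinearPMap.eq_of_eq_graph
    (hclosable.graph_closure_eq_closure_graph.symm.trans hcl)
  have hadj : T.adjoint = L := LinearPMap.eq_of_eq_graph
    ((LinearPMap.adjoint_graph_eq_graph_adjoint hdense).trans hL.symm)
  have hdenseL : Dense (L.domain : Set H) := hdense.mono hTL.1
  refine ⟨hdense, ?_, hclosable, hclos, hadj, ?_⟩
  · intro x y
    have h := LinearPMap.adjoint_isFormalAdjoint hdense
    rw [hadj] at h
    have hx := h ⟨x, hTL.1 x.2⟩ y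
    rwa [← hTL.2 (x := x) (y := ⟨x, hTL.1 x.2⟩) rfl] at hx
  · refine LinearPMap.eq_of_eq_graph ?_
    rw [LinearPMap.adjoint_graph_eq_graph_adjoint hdenseL, ← hcl, adjoint_topologicalClosure,
      ← hL, hcl]

end Abstract

section Primitives

open scoped ComplexConjugate

theorem absolutelyContinuousOnInterval_comp {X Y : Type*} [PseudoMetricSpace X]
    [PseudoMetricSpace Y] {f : ℝ → X} {k : X → Y} {a b : ℝ}
    (hk : ∀ x y, dist (k x) (k y) ≤ dist x y) (hf : AbsolutelyContinuousOnInterval f a b) :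
    AbsolutelyContinuousOnInterval (fun x => k (f x)) a b := by
  rw [absolutelyContinuousOnInterval_iff] at hf ⊢
  intro ε hε
  obtain ⟨δ, hδ, h⟩ := hf ε hε
  exact ⟨δ, hδ, fun E hE hlen =>
    (Finset.sum_le_sum fun i _ => hk _ _).trans_lt (h E hE hlen)⟩

theorem dist_re_le (x y : ℂ) : dist x.re y.re ≤ dist x y := by
  rw [Real.dist_eq, Complex.dist_eq, ← Complex.sub_re]
  exact Complex.abs_re_le_norm _

theorem dist_im_le (x y : ℂ) : dist x.im y.im ≤ dist x y := by
  rw [Real.dist_eq, Complex.dist_eq, ← Complex.sub_im]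
  exact Complex.abs_im_le_norm _

/-- `u` is locally absolutely continuous and `U` is its derivative almost everywhere. -/
def IsPrimitive (u U : ℝ → ℂ) : Prop :=
  ACLoc u ∧ ∀ᵐ x, HasDerivAt u (U x) x

variable {u v U V : ℝ → ℂ}

theorem ACLoc.isPrimitive (hu : ACLoc u) : IsPrimitive u (deriv u) :=
  ⟨hu, hu.ae_differentiableAt.mono fun _ h => h.hasDerivAt⟩

namespace IsPrimitive

theorem continuous (h : IsPrimitive u U) : Continuous u := h.1.continuous

theorem deriv_ae (h : IsPrimitive u U) : deriv u =ᵐ[volume] U := h.2.mono fun _ h => h.deriv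

theorem congr (h : IsPrimitive u U) (hUV : U =ᵐ[volume] V) : IsPrimitive u V :=
  ⟨h.1, by filter_upwards [h.2, hUV] with x h1 h2; rwa [← h2]⟩

theorem add (hu : IsPrimitive u U) (hv : IsPrimitive v V) :
    IsPrimitive (fun x => u x + v x) (fun x => U x + V x) :=
  ⟨fun a b => (hu.1 a b).add (hv.1 a b), by
    filter_upwards [hu.2, hv.2] with x h1 h2 using h1.add h2⟩

theorem sub (hu : IsPrimitive u U) (hv : IsPrimitive v V) :
    IsPrimitive (fun x => u x - v x) (fun x => U x - V x) :=
  ⟨fun a b => (hu.1 a b).sub (hv.1 a b), by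
    filter_upwards [hu.2, hv.2] with x h1 h2 using h1.sub h2⟩

theorem mul (hu : IsPrimitive u U) (hv : IsPrimitive v V) :
    IsPrimitive (fun x => u x * v x) (fun x => U x * v x + u x * V x) :=
  ⟨fun a b => (hu.1 a b).smul (hv.1 a b), by
    filter_upwards [hu.2, hv.2] with x h1 h2 using h1.mul h2⟩

theorem const_mul (c : ℂ) (hu : IsPrimitive u U) :
    IsPrimitive (fun x => c * u x) (fun x => c * U x) :=
  ⟨fun a b => (hu.1 a b).const_smul c, by
    filter_upwards [hu.2] with x h1 using h1.const_mul c⟩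

theorem conjugate (hu : IsPrimitive u U) :
    IsPrimitive (fun x => conj (u x)) (fun x => conj (U x)) :=
  ⟨fun a b => absolutelyContinuousOnInterval_comp
    (fun x y => (Complex.dist_conj_conj x y).le) (hu.1 a b), by
    filter_upwards [hu.2] with x h1 using h1.star⟩

theorem ofReal_of_contDiff {φ : ℝ → ℝ} (hφ : ContDiff ℝ 1 φ) :
    IsPrimitive (fun x => (φ x : ℂ)) (fun x => ((deriv φ x : ℝ) : ℂ)) :=
  ⟨fun a b => absolutelyContinuousOnInterval_comp (k := Complex.ofReal)
    (fun x y => (Complex.isometry_ofReal.dist_eq x y).le)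
    hφ.contDiffOn.absolutelyContinuousOnInterval,
    Eventually.of_forall fun x =>
      ((hφ.differentiable (by norm_num)).differentiableAt.hasDerivAt).ofReal_comp⟩

theorem intervalIntegrable_and_integral_eq (h : IsPrimitive u U) (a b : ℝ) :
    IntervalIntegrable U volume a b ∧ ∫ x in a..b, U x = u b - u a := by
  have hre := absolutelyContinuousOnInterval_comp dist_re_le (h.1 a b)
  have him := absolutelyContinuousOnInterval_comp dist_im_le (h.1 a b)
  have dre : ∀ᵐ x, deriv (fun x => (u x).re) x = (U x).re := h.2.mono fun x hx =>
    ((Complex.reCLM.hasFDerivAt.comp_hasDerivAt x hx).deriv)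
  have dim : ∀ᵐ x, deriv (fun x => (u x).im) x = (U x).im := h.2.mono fun x hx =>
    ((Complex.imCLM.hasFDerivAt.comp_hasDerivAt x hx).deriv)
  have ire : IntervalIntegrable (fun x => (U x).re) volume a b :=
    hre.intervalIntegrable_deriv.congr_ae (ae_restrict_of_ae dre)
  have iim : IntervalIntegrable (fun x => (U x).im) volume a b :=
    him.intervalIntegrable_deriv.congr_ae (ae_restrict_of_ae dim)
  have hU : U = fun x => ((U x).re : ℂ) + ((U x).im : ℂ) * Complex.I := by
    ext x; exact (Complex.re_add_im _).symm
  have ire' : IntervalIntegrable (fun x => ((U x).re : ℂ)) volume a b := by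
    exact ⟨ire.1.ofReal, ire.2.ofReal⟩
  have iim' : IntervalIntegrable (fun x => ((U x).im : ℂ) * Complex.I) volume a b := by
    exact ⟨iim.1.ofReal.mul_const _, iim.2.ofReal.mul_const _⟩
  constructor
  · rw [hU]; exact ire'.add iim'
  · rw [hU, intervalIntegral.integral_add ire' iim', intervalIntegral.integral_mul_const,
      intervalIntegral.integral_ofReal, intervalIntegral.integral_ofReal,
      ← intervalIntegral.integral_congr_ae (dre.mono fun x hx _ => hx),
      ← intervalIntegral.integral_congr_ae (dim.mono fun x hx _ => hx),
      hre.integral_deriv_eq_sub, him.integral_deriv_eq_sub]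
    apply Complex.ext <;> simp

theorem intervalIntegrable (h : IsPrimitive u U) (a b : ℝ) : IntervalIntegrable U volume a b :=
  (h.intervalIntegrable_and_integral_eq a b).1

theorem integral_eq (h : IsPrimitive u U) (a b : ℝ) : ∫ x in a..b, U x = u b - u a :=
  (h.intervalIntegrable_and_integral_eq a b).2

theorem of_integral (hU : LocallyIntegrable U volume) {c : ℂ} {x₀ : ℝ}
    (hu : ∀ x, u x = c + ∫ t in x₀..x, U t) : IsPrimitive u U := by
  have hUi : ∀ a b, IntervalIntegrable U volume a b := fun a b =>
    (hU.integrableOn_isCompact isCompact_uIcc).intervalIntegrable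
  have huc : u = fun x => c + ∫ t in x₀..x, U t := funext hu
  constructor
  · intro a b
    obtain ⟨m, M, hm, hx₀⟩ : ∃ m M, uIcc a b ⊆ uIcc m M ∧ x₀ ∈ uIcc m M := by
      refine ⟨min (min a b) x₀, max (max a b) x₀, ?_, ?_⟩
      · rw [uIcc_of_le (a := min (min a b) x₀) (by simp)]
        exact Icc_subset_Icc (min_le_left _ _) (le_max_left _ _)
      · rw [uIcc_of_le (by simp)]
        exact ⟨min_le_right _ _, le_max_right _ _⟩
    refine AbsolutelyContinuousOnInterval.mono ?_ hm
    have hre : IntervalIntegrable (fun x => (U x).re) volume m M :=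
      ⟨(hUi m M).1.re, (hUi m M).2.re⟩
    have him : IntervalIntegrable (fun x => (U x).im) volume m M :=
      ⟨(hUi m M).1.im, (hUi m M).2.im⟩
    have h1 := absolutelyContinuousOnInterval_comp (k := Complex.ofReal)
      (fun x y => (Complex.isometry_ofReal.dist_eq x y).le)
      (hre.absolutelyContinuousOnInterval_intervalIntegral hx₀)
    have h2 := (absolutelyContinuousOnInterval_comp (k := Complex.ofReal)
      (fun x y => (Complex.isometry_ofReal.dist_eq x y).le)
      (him.absolutelyContinuousOnInterval_intervalIntegral hx₀)).const_smul Complex.I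
    have h0 : AbsolutelyContinuousOnInterval (fun _ : ℝ => c) m M :=
      contDiff_const.contDiffOn.absolutelyContinuousOnInterval
    convert! h0.add (h1.add h2) using 1
    rw [huc]
    ext x
    have e1 : ((∫ t in x₀..x, U t).re) = ∫ t in x₀..x, (U t).re :=
      (Complex.reCLM.intervalIntegral_comp_comm (hUi x₀ x)).symm
    have e2 : ((∫ t in x₀..x, U t).im) = ∫ t in x₀..x, (U t).im :=
      (Complex.imCLM.intervalIntegral_comp_comm (hUi x₀ x)).symm
    rw [← Complex.re_add_im (∫ t in x₀..x, U t), e1, e2]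
    simp [mul_comm]
  · filter_upwards [_root_.LocallyIntegrable.ae_hasDerivAt_integral hU] with x hx
    rw [huc]
    exact (hx x₀).const_add c

end IsPrimitive

/-- The pair `(u, v)` solves the first order system `u' = α v + β u`, `v' = -β̄ v - γ u - g`. -/
structure IsSolution (α : ℝ → ℝ) (β : ℝ → ℂ) (γ : ℝ → ℝ) (g u v : ℝ → ℂ) : Prop where
  fst : IsPrimitive u fun x => (α x : ℂ) * v x + β x * u x
  snd : IsPrimitive v fun x => -(conj (β x)) * v x - (γ x : ℂ) * u x - g x

/-- Green's formula. -/
theorem IsSolution.green {α γ : ℝ → ℝ} {β g h u v w z : ℝ → ℂ} (huv : IsSolution α β γ g u v)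
    (hwz : IsSolution α β γ h w z) :
    IsPrimitive (fun x => u x * conj (z x) - v x * conj (w x))
      (fun x => g x * conj (w x) - u x * conj (h x)) := by
  refine ((huv.fst.mul hwz.snd.conjugate).sub (huv.snd.mul hwz.fst.conjugate)).congr
    (Eventually.of_forall fun x => ?_)
  simp only [map_sub, map_add, map_mul, map_neg, Complex.conj_conj, Complex.conj_ofReal]
  ring

end Primitives

section Existence

open scoped ComplexConjugate BoundedContinuousFunction NNReal

/-- Solvability of the integral equation `y x = y₀ + ∫ F(t, y(t)) dt` on the whole line, if `F` is
Lipschitz in the second variable with an integrable constant of total mass less than one. -/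
theorem exists_integral_equation_solution {E : Type*} [NormedAddCommGroup E] [NormedSpace ℝ E]
    [CompleteSpace E] {F : ℝ → E → E} {k : ℝ → ℝ} (hk : Integrable k volume)
    (hk1 : ∫ t, k t < 1) (hF : ∀ y : ℝ →ᵇ E, Integrable (fun t => F t (y t)) volume)
    (hlip : ∀ t x y, ‖F t x - F t y‖ ≤ k t * ‖x - y‖) (x₀ : ℝ) (y₀ : E) :
    ∃ y : ℝ →ᵇ E, ∀ x, y x = y₀ + ∫ t in x₀..x, F t (y t) := by
  have hcont : ∀ y : ℝ →ᵇ E, Continuous fun x => y₀ + ∫ t in x₀..x, F t (y t) := fun y =>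
    continuous_const.add (intervalIntegral.continuous_primitive
      (fun a b => (hF y).intervalIntegrable) x₀)
  have hbound : ∀ (f : ℝ → E), Integrable f volume → ∀ x,
      ‖∫ t in x₀..x, f t‖ ≤ ∫ t, ‖f t‖ := fun f hf x =>
    (intervalIntegral.norm_integral_le_integral_norm_uIoc).trans
      (setIntegral_le_integral hf.norm (Eventually.of_forall fun _ => norm_nonneg _))
  let Φ : (ℝ →ᵇ E) → (ℝ →ᵇ E) := fun y =>
    BoundedContinuousFunction.ofNormedAddCommGroup (fun x => y₀ + ∫ t in x₀..x, F t (y t))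
      (hcont y) (‖y₀‖ + ∫ t, ‖F t (y t)‖)
      (fun x => (norm_add_le _ _).trans (add_le_add_right (hbound _ (hF y) x) _))
  have hk0 : ∀ t, (0 : ℝ) ≤ k t ∨ ∀ x y : E, x = y := by
    intro t
    by_contra! h
    obtain ⟨h1, x, y, hxy⟩ := h
    have := (norm_nonneg _).trans (hlip t x y)
    have : 0 < ‖x - y‖ := norm_pos_iff.2 (sub_ne_zero.2 hxy)
    nlinarith
  set K : ℝ≥0 := Real.toNNReal (∫ t, k t)
  have hK : K < 1 := by
    rw [← Real.toNNReal_one]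
    exact (Real.toNNReal_lt_toNNReal_iff one_pos).2 hk1
  have hcontr : ContractingWith K Φ := by
    refine ⟨hK, LipschitzWith.of_dist_le_mul fun y z => ?_⟩
    refine (BoundedContinuousFunction.dist_le (by positivity)).2 fun x => ?_
    have hsub : Φ y x - Φ z x = ∫ t in x₀..x, (F t (y t) - F t (z t)) := by
      rw [intervalIntegral.integral_sub (hF y).intervalIntegrable (hF z).intervalIntegrable]
      simp [Φ]
    rw [dist_eq_norm, hsub]
    calc ‖∫ t in x₀..x, (F t (y t) - F t (z t))‖
        ≤ ∫ t, ‖F t (y t) - F t (z t)‖ := hbound _ ((hF y).sub (hF z)) x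
      _ ≤ ∫ t, k t * dist y z := by
          refine integral_mono ((hF y).sub (hF z)).norm (hk.mul_const _) fun t => ?_
          refine (hlip t _ _).trans ?_
          rcases hk0 t with h | h
          · refine mul_le_mul_of_nonneg_left ?_ h
            rw [← dist_eq_norm]
            exact BoundedContinuousFunction.dist_coe_le_dist t
          · rw [h (y t) (z t), BoundedContinuousFunction.ext fun t => h (y t) (z t)]
            simp
      _ = (∫ t, k t) * dist y z := integral_mul_const _ _
      _ ≤ K * dist y z := mul_le_mul_of_nonneg_right (Real.le_coe_toNNReal _) dist_nonneg
  refine ⟨ContractingWith.fixedPoint Φ hcontr, fun x => ?_⟩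
  exact congrArg (fun y : ℝ →ᵇ E => y x) hcontr.fixedPoint_isFixedPt.symm

/-- The initial value problem for the first order system is solvable if the coefficients are
integrable with small norms. -/
theorem exists_isSolution {α γ : ℝ → ℝ} {β g : ℝ → ℂ} (hα : Integrable α volume)
    (hβ : Integrable β volume) (hγ : Integrable γ volume) (hg : Integrable g volume)
    (hsmall : ∫ t, (|α t| + 2 * ‖β t‖ + |γ t|) < 1) (x₀ : ℝ) (a b : ℂ) :
    ∃ u v, IsSolution α β γ g u v ∧ u x₀ = a ∧ v x₀ = b := by
  let F : ℝ → ℂ × ℂ → ℂ × ℂ := fun t y =>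
    ((α t : ℂ) * y.2 + β t * y.1, -(conj (β t)) * y.2 - (γ t : ℂ) * y.1 - g t)
  have hmul : ∀ (f : ℝ → ℂ) (y : ℝ →ᵇ ℂ × ℂ), Integrable f volume →
      Integrable (fun t => f t * (y t).1) volume ∧ Integrable (fun t => f t * (y t).2) volume := by
    intro f y hf
    refine ⟨hf.mul_bdd (c := ‖y‖) (by fun_prop) (Eventually.of_forall fun t => ?_),
      hf.mul_bdd (c := ‖y‖) (by fun_prop) (Eventually.of_forall fun t => ?_)⟩
    · exact (norm_fst_le (y t)).trans (y.norm_coe_le_norm t)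
    · exact (norm_snd_le (y t)).trans (y.norm_coe_le_norm t)
  have hβ' : Integrable (fun t => -(conj (β t))) volume :=
    ((Complex.conjCLE.toContinuousLinearMap.integrable_comp hβ)).neg
  have hF : ∀ y : ℝ →ᵇ ℂ × ℂ, Integrable (fun t => F t (y t)) volume := fun y =>
    ((hmul _ y hα.ofReal).2.add (hmul _ y hβ).1).prodMk
      (((hmul _ y hβ').2.sub (hmul _ y hγ.ofReal).1).sub hg)
  have hlip : ∀ t x y, ‖F t x - F t y‖ ≤ (|α t| + 2 * ‖β t‖ + |γ t|) * ‖x - y‖ := by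
    intro t x y
    have h1 := norm_fst_le (x - y)
    have h2 := norm_snd_le (x - y)
    set N := ‖x - y‖
    have hα0 := abs_nonneg (α t)
    have hβ0 := norm_nonneg (β t)
    have hγ0 := abs_nonneg (γ t)
    have hN : 0 ≤ N := norm_nonneg _
    refine max_le ?_ ?_
    · have e : (F t x - F t y).1 = (α t : ℂ) * (x - y).2 + β t * (x - y).1 := by
        simp only [F, Prod.fst_sub, Prod.snd_sub]; ring
      rw [e]
      refine (norm_add_le _ _).trans ?_
      rw [norm_mul, norm_mul, Complex.norm_real, Real.norm_eq_abs]
      nlinarith [mul_le_mul_of_nonneg_left h2 hα0, mul_le_mul_of_nonneg_left h1 hβ0,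
        mul_nonneg hβ0 hN, mul_nonneg hγ0 hN]
    · have e : (F t x - F t y).2 = -(conj (β t)) * (x - y).2 - (γ t : ℂ) * (x - y).1 := by
        simp only [F, Prod.fst_sub, Prod.snd_sub]; ring
      rw [e]
      refine (norm_sub_le _ _).trans ?_
      rw [norm_mul, norm_mul, Complex.norm_real, Real.norm_eq_abs, norm_neg, RCLike.norm_conj]
      nlinarith [mul_le_mul_of_nonneg_left h1 hγ0, mul_le_mul_of_nonneg_left h2 hβ0,
        mul_nonneg hβ0 hN, mul_nonneg hα0 hN]
  have hk : Integrable (fun t => |α t| + 2 * ‖β t‖ + |γ t|) volume :=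
    (hα.abs.add (hβ.norm.const_mul 2)).add hγ.abs
  obtain ⟨y, hy⟩ := exists_integral_equation_solution hk hsmall hF hlip x₀ (a, b)
  have h1 : ∀ x, (y x).1 = a + ∫ t in x₀..x, (F t (y t)).1 := fun x => by
    have := (ContinuousLinearMap.fst ℝ ℂ ℂ).intervalIntegral_comp_comm
      (μ := volume) (a := x₀) (b := x) (hF y).intervalIntegrable
    rw [hy x]
    exact congrArg (a + ·) this.symm
  have h2 : ∀ x, (y x).2 = b + ∫ t in x₀..x, (F t (y t)).2 := fun x => by
    have := (ContinuousLinearMap.snd ℝ ℂ ℂ).intervalIntegral_comp_comm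
      (μ := volume) (a := x₀) (b := x) (hF y).intervalIntegrable
    rw [hy x]
    exact congrArg (b + ·) this.symm
  refine ⟨fun x => (y x).1, fun x => (y x).2,
    ⟨.of_integral (hF y).fst.locallyIntegrable h1, .of_integral (hF y).snd.locallyIntegrable h2⟩,
    ?_, ?_⟩
  · simpa using h1 x₀
  · simpa using h2 x₀

end Existence

section Regularity

open scoped ComplexConjugate Topology

/-- `f` has a representative `u` that is the first component of a solution `(u, v)` of the first
order system with right-hand side `g`. -/
def IsPair (α : ℝ → ℝ) (β : ℝ → ℂ) (γ : ℝ → ℝ) (f g : L2) : Prop :=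
  ∃ u v, IsSolution α β γ g u v ∧ f =ᵐ[volume] u

theorem inner_eq_integral {f g : L2} {u w : ℝ → ℂ} (hf : f =ᵐ[volume] u) (hg : g =ᵐ[volume] w) :
    inner ℂ f g = ∫ x, w x * conj (u x) := by
  rw [L2.inner_def]
  refine integral_congr_ae ?_
  filter_upwards [hf, hg] with x h1 h2
  rw [h1, h2, RCLike.inner_apply]

theorem memLp_indicator_Ioc {y : ℝ → ℂ} (hy : Continuous y) (a b : ℝ) :
    MemLp ((Ioc a b).indicator y) 2 volume := by
  rw [memLp_indicator_iff_restrict measurableSet_Ioc]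
  obtain ⟨C, hC⟩ := isCompact_Icc.exists_bound_of_continuousOn (s := Icc a b) hy.continuousOn
  refine MemLp.of_bound hy.aestronglyMeasurable C ?_
  filter_upwards [ae_restrict_mem measurableSet_Ioc] with x hx
  exact hC x (Ioc_subset_Icc_self hx)

theorem IsSolution.add_const_mul {α γ : ℝ → ℝ} {β g u v y z : ℝ → ℂ}
    (h : IsSolution α β γ g u v) (h₀ : IsSolution α β γ 0 y z) (c : ℂ) :
    IsSolution α β γ g (fun x => u x + c * y x) (fun x => v x + c * z x) := by
  constructor
  · refine (h.fst.add (h₀.fst.const_mul c)).congr (Eventually.of_forall fun x => ?_)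
    simp only; ring
  · refine (h.snd.add (h₀.snd.const_mul c)).congr (Eventually.of_forall fun x => ?_)
    simp only [Pi.zero_apply]; ring

theorem IsPrimitive.eq_of_Ioc {u U : ℝ → ℂ} (h : IsPrimitive u U) {a b : ℝ} (hab : a ≤ b)
    (hU : ∀ x ∈ Ioc a b, U x = 0) : u a = u b := by
  have h1 := h.integral_eq a b
  rw [intervalIntegral.integral_of_le hab,
    setIntegral_congr_fun (g := fun _ => 0) measurableSet_Ioc hU] at h1
  simpa using (sub_eq_zero.1 (h1.symm.trans (by simp))).symm

/-- A solution of the system truncated to `(a, b]` that vanishes at both ends vanishes outside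
`(a, b]`, and it solves the original system. -/
theorem IsSolution.of_indicator {α γ : ℝ → ℝ} {β h u v : ℝ → ℂ} {a b : ℝ}
    (huv : IsSolution ((Ioc a b).indicator α) ((Ioc a b).indicator β) ((Ioc a b).indicator γ)
      ((Ioc a b).indicator h) u v)
    (hua : u a = 0) (hva : v a = 0) (hub : u b = 0) (hvb : v b = 0) :
    (∀ x ∉ Ioc a b, u x = 0) ∧ IsSolution α β γ ((Ioc a b).indicator h) u v := by
  have key : ∀ {y Y : ℝ → ℂ}, IsPrimitive y Y → (∀ x ∉ Ioc a b, Y x = 0) → y a = 0 → y b = 0 →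
      ∀ x ∉ Ioc a b, y x = 0 := by
    intro y Y hy hY hya hyb x hx
    rcases le_or_gt x a with h | h
    · rw [hy.eq_of_Ioc h fun t ht => hY t fun ht' => ?_, hya]
      exact absurd ht.2 (not_le.2 ht'.1)
    · have hbx : b ≤ x := by
        by_contra! hb
        exact hx ⟨h, hb.le⟩
      rw [← hy.eq_of_Ioc hbx fun t ht => hY t fun ht' => ?_, hyb]
      exact absurd ht.1 (not_lt.2 ht'.2)
  have hu := key huv.fst (fun x hx => by simp [hx]) hua hub
  have hv := key huv.snd (fun x hx => by simp [hx]) hva hvb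
  refine ⟨hu, huv.fst.congr (Eventually.of_forall fun x => ?_),
    huv.snd.congr (Eventually.of_forall fun x => ?_)⟩
  · by_cases hx : x ∈ Ioc a b
    · simp [hx]
    · simp [hx, hu x hx, hv x hx]
  · by_cases hx : x ∈ Ioc a b
    · simp [hx]
    · simp [hx, hu x hx, hv x hx]

variable {α γ : ℝ → ℝ} {β : ℝ → ℂ} {f g : L2}

/-- Interior regularity on a short interval: a weak solution coincides with a solution. -/
theorem exists_isSolution_of_weak (hα : LocallyIntegrable α volume)
    (hβ : LocallyIntegrable β volume) (hγ : LocallyIntegrable γ volume)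
    (hweak : ∀ F G : L2, IsPair α β γ F G → F ∈ compactlySupported → inner ℂ G f = inner ℂ F g)
    {a b : ℝ} (hab : a < b) (hsmall : ∫ t in Ioc a b, (|α t| + 2 * ‖β t‖ + |γ t|) < 1) :
    ∃ u v, IsSolution ((Ioc a b).indicator α) ((Ioc a b).indicator β) ((Ioc a b).indicator γ)
      ((Ioc a b).indicator g) u v ∧ ∀ᵐ x, x ∈ Ioc a b → f x = u x := by
  set J := Ioc a b with hJ
  have hJm : MeasurableSet J := measurableSet_Ioc
  have hloc : ∀ {E : Type} [NormedAddCommGroup E] {k : ℝ → E}, LocallyIntegrable k volume →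
      Integrable (J.indicator k) volume := fun hk =>
    (integrable_indicator_iff hJm).2
      ((hk.integrableOn_isCompact isCompact_Icc).mono_set Ioc_subset_Icc_self)
  have hL2 : ∀ k : L2, MemLp (J.indicator k) 2 volume := fun k => (Lp.memLp k).indicator hJm
  have hL2i : ∀ k : L2, Integrable (J.indicator k) volume := fun k =>
    (integrable_indicator_iff hJm).2 (((Lp.memLp k).restrict J).integrable (by norm_num))
  have hsmall' : ∫ t, (|J.indicator α t| + 2 * ‖J.indicator β t‖ + |J.indicator γ t|) < 1 := by
    rw [← integral_indicator hJm] at hsmall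
    refine lt_of_eq_of_lt (integral_congr_ae (Eventually.of_forall fun t => ?_)) hsmall
    by_cases ht : t ∈ J <;> simp [ht]
  have hsolve : ∀ h : ℝ → ℂ, Integrable h volume → ∀ (x₀ : ℝ) (c d : ℂ), ∃ u v,
      IsSolution (J.indicator α) (J.indicator β) (J.indicator γ) h u v ∧ u x₀ = c ∧ v x₀ = d :=
    fun h hh => exists_isSolution (hloc hα) (hloc hβ) (hloc hγ) hh hsmall'
  have hint : ∀ k : ℝ → ℂ, (∀ x ∉ J, k x = 0) → ∫ x, k x = ∫ x in a..b, k x := by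
    intro k hk
    rw [intervalIntegral.integral_of_le hab.le, setIntegral_eq_integral_of_forall_compl_eq_zero hk]
  obtain ⟨w, z, hwz, -, -⟩ := hsolve _ (hL2i g) a 0 0
  obtain ⟨y₁, z₁, hyz₁, hy₁, hz₁⟩ := hsolve 0 (integrable_zero _ _ _) b 1 0
  obtain ⟨y₂, z₂, hyz₂, hy₂, hz₂⟩ := hsolve 0 (integrable_zero _ _ _) b 0 1
  set e₁ : L2 := (memLp_indicator_Ioc hyz₁.fst.continuous a b).toLp with he₁
  set e₂ : L2 := (memLp_indicator_Ioc hyz₂.fst.continuous a b).toLp with he₂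
  have ae₁ : e₁ =ᵐ[volume] J.indicator y₁ := MemLp.coeFn_toLp _
  have ae₂ : e₂ =ᵐ[volume] J.indicator y₂ := MemLp.coeFn_toLp _
  have hFmem : MemLp (fun x => J.indicator f x - J.indicator w x) 2 volume :=
    (hL2 f).sub (memLp_indicator_Ioc hwz.fst.continuous a b)
  set F : L2 := hFmem.toLp with hF
  have aeF : F =ᵐ[volume] fun x => J.indicator f x - J.indicator w x := MemLp.coeFn_toLp _
  have hFspan : F ∈ Submodule.span ℂ {e₁, e₂} := by
    have : FiniteDimensional ℂ (Submodule.span ℂ {e₁, e₂}) :=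
      FiniteDimensional.span_of_finite ℂ (toFinite _)
    rw [← Submodule.orthogonal_orthogonal (Submodule.span ℂ {e₁, e₂}), Submodule.mem_orthogonal]
    intro h hh
    have orth : ∀ e ∈ ({e₁, e₂} : Set L2), inner ℂ e h = 0 := fun e he =>
      (Submodule.mem_orthogonal _ h).1 hh e (Submodule.subset_span he)
    obtain ⟨u, v, huv, hua, hva⟩ := hsolve _ (hL2i h) a 0 0
    have boundary : ∀ (e : L2) (y y' : ℝ → ℂ), inner ℂ e h = 0 → e =ᵐ[volume] J.indicator y →
        IsSolution (J.indicator α) (J.indicator β) (J.indicator γ) 0 y y' →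
        u b * conj (y' b) - v b * conj (y b) = 0 := by
      intro e y y' h0 ae hy
      have h1 := (huv.green hy).integral_eq a b
      rw [hua, hva, inner_eq_integral ae (EventuallyEq.refl _ _)] at *
      rw [hint _ fun x hx => by simp [hx]] at h0
      rw [zero_mul, zero_mul, sub_zero, sub_zero] at h1
      rw [← h1, ← h0]
      refine intervalIntegral.integral_congr_ae (Eventually.of_forall fun x hx => ?_)
      rw [uIoc_of_le hab.le] at hx
      simp [indicator_of_mem (show x ∈ J from hx)]
    have hvb : v b = 0 := by
      have := boundary e₁ y₁ z₁ (orth _ (by simp)) ae₁ hyz₁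
      simpa [hy₁, hz₁] using this
    have hub : u b = 0 := by
      have := boundary e₂ y₂ z₂ (orth _ (by simp)) ae₂ hyz₂
      simpa [hy₂, hz₂] using this
    obtain ⟨hu0, huv'⟩ := huv.of_indicator hua hva hub hvb
    have hsupp : HasCompactSupport u := HasCompactSupport.intro (isCompact_Icc (a := a) (b := b))
      fun x hx => hu0 x fun hx' => hx (Ioc_subset_Icc_self hx')
    have humem : MemLp u 2 volume := huv.fst.continuous.memLp_of_hasCompactSupport hsupp
    have aeu : humem.toLp =ᵐ[volume] u := MemLp.coeFn_toLp _
    have aeh : (hL2 h).toLp =ᵐ[volume] J.indicator h := MemLp.coeFn_toLp _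
    have hw := hweak humem.toLp (hL2 h).toLp
      ⟨u, v, ⟨huv'.fst, huv'.snd.congr (aeh.mono fun x hx => congrArg (_ - ·) hx.symm)⟩, aeu⟩
      ⟨u, hsupp, aeu⟩
    rw [inner_eq_integral aeh (EventuallyEq.refl _ _),
      inner_eq_integral aeu (EventuallyEq.refl _ _), hint _ fun x hx => by simp [hx],
      hint _ fun x hx => by simp [hu0 x hx]] at hw
    have hgreen := (hwz.green huv).integral_eq a b
    rw [hua, hva, hub, hvb] at hgreen
    rw [inner_eq_integral (EventuallyEq.refl _ _) aeF, hint _ fun x hx => by simp [hx]]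
    have i1 : IntervalIntegrable (fun x => f x * conj (J.indicator h x)) volume a b := by
      have := L2.integrable_inner (𝕜 := ℂ) (hL2 h).toLp f
      refine (this.congr ?_).intervalIntegrable
      filter_upwards [aeh] with x hx
      rw [RCLike.inner_apply, hx]
    have i2 : IntervalIntegrable (fun x => w x * conj (J.indicator h x)) volume a b :=
      IntervalIntegrable.continuousOn_mul (Complex.conjCLE.toContinuousLinearMap.integrable_comp
        (hL2i h)).intervalIntegrable hwz.fst.continuous.continuousOn
    have i3 : IntervalIntegrable (fun x => g x * conj (u x)) volume a b := by
      have := L2.integrable_inner (𝕜 := ℂ) humem.toLp g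
      refine (this.congr ?_).intervalIntegrable
      filter_upwards [aeu] with x hx
      rw [RCLike.inner_apply, hx]
    have e1 : ∫ x in a..b, (J.indicator f x - J.indicator w x) * conj (h x)
        = ∫ x in a..b, (f x * conj (J.indicator h x) - w x * conj (J.indicator h x)) := by
      refine intervalIntegral.integral_congr_ae (Eventually.of_forall fun x hx => ?_)
      rw [uIoc_of_le hab.le] at hx
      simp [indicator_of_mem (show x ∈ J from hx), sub_mul]
    have e2 : ∫ x in a..b, (J.indicator g x * conj (u x) - w x * conj (J.indicator h x))
        = ∫ x in a..b, (g x * conj (u x) - w x * conj (J.indicator h x)) := by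
      refine intervalIntegral.integral_congr_ae (Eventually.of_forall fun x hx => ?_)
      rw [uIoc_of_le hab.le] at hx
      simp [indicator_of_mem (show x ∈ J from hx)]
    rw [e2, intervalIntegral.integral_sub i3 i2] at hgreen
    rw [e1, intervalIntegral.integral_sub i1 i2, hw, hgreen]
    simp
  obtain ⟨c₁, c₂, hc⟩ := Submodule.mem_span_pair.1 hFspan
  refine ⟨_, _, (hwz.add_const_mul hyz₁ c₁).add_const_mul hyz₂ c₂, ?_⟩
  filter_upwards [ae₁, ae₂, aeF, Lp.coeFn_add (c₁ • e₁) (c₂ • e₂), Lp.coeFn_smul c₁ e₁,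
    Lp.coeFn_smul c₂ e₂] with x h1 h2 h3 h4 h5 h6 hx
  rw [← hc, h4, Pi.add_apply, h5, h6, Pi.smul_apply, Pi.smul_apply, h1, h2] at h3
  simp only [indicator_of_mem hx, smul_eq_mul] at h3
  rw [add_assoc, h3]
  ring

theorem locallyIntegrable_norm {E : Type*} [NormedAddCommGroup E] {k : ℝ → E}
    (hk : LocallyIntegrable k volume) : LocallyIntegrable (fun x => ‖k x‖) volume := fun x => by
  obtain ⟨s, hs, h⟩ := hk x
  exact ⟨s, hs, h.norm⟩

/-- A function that locally coincides with primitives of `G` is a primitive of `G`. -/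
theorem IsPrimitive.of_local {u G : ℝ → ℂ} (hG : LocallyIntegrable G volume)
    (h : ∀ x : ℝ, ∃ δ > 0, ∃ U D, IsPrimitive U D ∧ (∀ y ∈ Ioo (x - δ) (x + δ), u y = U y) ∧
      ∀ᵐ y, y ∈ Ioo (x - δ) (x + δ) → D y = G y) : IsPrimitive u G := by
  have hGi : ∀ a b, IntervalIntegrable G volume a b := fun a b =>
    (hG.integrableOn_isCompact isCompact_uIcc).intervalIntegrable
  have hconst : IsLocallyConstant fun x => u x - ∫ t in (0 : ℝ)..x, G t := by
    rw [IsLocallyConstant.iff_eventually_eq]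
    intro x
    obtain ⟨δ, hδ, U, D, hU, huU, hDG⟩ := h x
    have hx : x ∈ Ioo (x - δ) (x + δ) := ⟨by linarith, by linarith⟩
    filter_upwards [Ioo_mem_nhds hx.1 hx.2] with y hy
    have h1 : ∫ t in x..y, D t = ∫ t in x..y, G t := by
      refine intervalIntegral.integral_congr_ae (hDG.mono fun t ht hty => ht ?_)
      exact (ordConnected_Ioo.uIcc_subset hx hy) (uIoc_subset_uIcc hty)
    have h2 := hU.integral_eq x y
    have h3 := intervalIntegral.integral_interval_sub_left (hGi 0 y) (hGi 0 x)
    rw [h1, ← h3, ← huU x hx, ← huU y hy] at h2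
    linear_combination -h2
  refine IsPrimitive.of_integral hG (c := u 0) (x₀ := 0) fun x => ?_
  have := hconst.apply_eq_of_preconnectedSpace x 0
  simp only [intervalIntegral.integral_same, sub_zero] at this
  linear_combination this

theorem locallyIntegrable_mul_continuous {k y : ℝ → ℂ} (hk : LocallyIntegrable k volume)
    (hy : Continuous y) : LocallyIntegrable (fun x => k x * y x) volume := by
  rw [← locallyIntegrableOn_univ] at hk ⊢
  exact hk.mul_continuousOn hy.continuousOn isOpen_univ.isLocallyClosed

/-- Interior regularity: a weak solution is a solution. -/
theorem isPair_of_weak (hα : LocallyIntegrable α volume)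
    (hβ : LocallyIntegrable β volume) (hγ : LocallyIntegrable γ volume)
    (hα0 : ∀ᵐ x, α x ≠ 0)
    (hweak : ∀ F G : L2, IsPair α β γ F G → F ∈ compactlySupported →
      inner ℂ G f = inner ℂ F g) : IsPair α β γ f g := by
  have hlocal : ∀ x : ℝ, ∃ δ > 0, ∃ U V : ℝ → ℂ, ∃ D D' : ℝ → ℂ, IsPrimitive U D ∧
      IsPrimitive V D' ∧ ∀ᵐ y, y ∈ Ioo (x - δ) (x + δ) → f y = U y ∧
        D y = α y * V y + β y * U y ∧ D' y = -(conj (β y)) * V y - γ y * U y - g y := by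
    intro x
    have hk : LocallyIntegrable (fun t => |α t| + 2 * ‖β t‖ + |γ t|) volume :=
      (((locallyIntegrable_norm hα).add ((locallyIntegrable_norm hβ).smul (2 : ℝ))).add
        (locallyIntegrable_norm hγ))
    have hki : ∀ a b, IntervalIntegrable (fun t => |α t| + 2 * ‖β t‖ + |γ t|) volume a b :=
      fun a b => (hk.integrableOn_isCompact isCompact_uIcc).intervalIntegrable
    have hc := intervalIntegral.continuous_primitive hki 0
    have hc' : Continuous fun δ : ℝ => (∫ t in (0 : ℝ)..(x + δ), (|α t| + 2 * ‖β t‖ + |γ t|)) -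
        ∫ t in (0 : ℝ)..(x - δ), (|α t| + 2 * ‖β t‖ + |γ t|) :=
      (hc.comp (continuous_const.add continuous_id)).sub
        (hc.comp (continuous_const.sub continuous_id))
    have hev := (hc'.tendsto 0).eventually (eventually_lt_nhds (b := 1) (by simp))
    obtain ⟨δ, hδ1, hδ⟩ := ((hev.filter_mono nhdsWithin_le_nhds).and
      (self_mem_nhdsWithin (s := Ioi (0 : ℝ)))).exists
    rw [intervalIntegral.integral_interval_sub_left (hki _ _) (hki _ _)] at hδ1
    have hδ' : (0 : ℝ) < δ := hδ
    have hlt : x - δ < x + δ := by linarith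
    rw [intervalIntegral.integral_of_le hlt.le] at hδ1
    obtain ⟨U, V, hUV, hfU⟩ := exists_isSolution_of_weak hα hβ hγ hweak hlt hδ1
    refine ⟨δ, hδ, U, V, _, _, hUV.fst, hUV.snd, ?_⟩
    filter_upwards [hfU] with y hy hyJ
    have hyJ' := Ioo_subset_Ioc_self hyJ
    exact ⟨hy hyJ', by simp [hyJ'], by simp [hyJ']⟩
  choose δ hδ U V D D' hU hV hae using hlocal
  have hself : ∀ x, x ∈ Ioo (x - δ x) (x + δ x) := fun x =>
    ⟨by linarith [hδ x], by linarith [hδ x]⟩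
  have hUeq : ∀ x y, EqOn (U x) (U y) (Ioo (x - δ x) (x + δ x) ∩ Ioo (y - δ y) (y + δ y)) := by
    intro x y
    refine Measure.eqOn_open_of_ae_eq (μ := volume) ?_ (isOpen_Ioo.inter isOpen_Ioo)
      (hU x).continuous.continuousOn (hU y).continuous.continuousOn
    refine (ae_restrict_iff' (measurableSet_Ioo.inter measurableSet_Ioo)).2 ?_
    filter_upwards [hae x, hae y] with t h1 h2 ht
    rw [← (h1 ht.1).1, ← (h2 ht.2).1]
  have hVeq : ∀ x y, EqOn (V x) (V y) (Ioo (x - δ x) (x + δ x) ∩ Ioo (y - δ y) (y + δ y)) := by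
    intro x y
    have hopen : IsOpen (Ioo (x - δ x) (x + δ x) ∩ Ioo (y - δ y) (y + δ y)) :=
      isOpen_Ioo.inter isOpen_Ioo
    refine Measure.eqOn_open_of_ae_eq (μ := volume) ?_ hopen
      (hV x).continuous.continuousOn (hV y).continuous.continuousOn
    refine (ae_restrict_iff' (measurableSet_Ioo.inter measurableSet_Ioo)).2 ?_
    filter_upwards [hae x, hae y, hα0, (hU x).2, (hU y).2] with t h1 h2 h0 d1 d2 ht
    have hd : D x t = D y t := by
      rw [← d1.deriv, ← d2.deriv]
      exact Filter.EventuallyEq.deriv_eq ((hUeq x y).eventuallyEq_of_mem (hopen.mem_nhds ht))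
    rw [(h1 ht.1).2.1, (h2 ht.2).2.1, hUeq x y ht] at hd
    exact mul_left_cancel₀ (Complex.ofReal_ne_zero.2 h0) (add_right_cancel hd)
  have hu : ∀ x, ∀ y ∈ Ioo (x - δ x) (x + δ x), U y y = U x y := fun x y hy =>
    hUeq y x ⟨hself y, hy⟩
  have hv : ∀ x, ∀ y ∈ Ioo (x - δ x) (x + δ x), V y y = V x y := fun x y hy =>
    hVeq y x ⟨hself y, hy⟩
  have hglue : ∀ {W : ℝ → ℝ → ℂ}, (∀ x, Continuous (W x)) →
      (∀ x, ∀ y ∈ Ioo (x - δ x) (x + δ x), W y y = W x y) → Continuous fun x => W x x := by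
    intro W hW hWeq
    rw [continuous_iff_continuousAt]
    intro x
    refine (hW x).continuousAt.congr ?_
    filter_upwards [Ioo_mem_nhds (hself x).1 (hself x).2] with y hy
    exact (hWeq x y hy).symm
  have huc := hglue (fun x => (hU x).continuous) hu
  have hvc := hglue (fun x => (hV x).continuous) hv
  have hgloc : LocallyIntegrable g volume :=
    (Lp.memLp g).locallyIntegrable (by norm_num)
  have hαc : LocallyIntegrable (fun x => (α x : ℂ)) volume := fun x => by
    obtain ⟨s, hs, h⟩ := hα x
    exact ⟨s, hs, h.ofReal⟩
  have hγc : LocallyIntegrable (fun x => (γ x : ℂ)) volume := fun x => by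
    obtain ⟨s, hs, h⟩ := hγ x
    exact ⟨s, hs, h.ofReal⟩
  have hβc : LocallyIntegrable (fun x => -(conj (β x))) volume := fun x => by
    obtain ⟨s, hs, h⟩ := hβ x
    exact ⟨s, hs, (Complex.conjCLE.toContinuousLinearMap.integrable_comp h).neg⟩
  refine ⟨fun x => U x x, fun x => V x x, ⟨?_, ?_⟩, ?_⟩
  · refine IsPrimitive.of_local ((locallyIntegrable_mul_continuous hαc hvc).add
      (locallyIntegrable_mul_continuous hβ huc)) fun x => ⟨δ x, hδ x, U x, D x, hU x, hu x, ?_⟩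
    filter_upwards [hae x] with y hy hyI
    rw [(hy hyI).2.1, hu x y hyI, hv x y hyI]
  · refine IsPrimitive.of_local (((locallyIntegrable_mul_continuous hβc hvc).sub
      (locallyIntegrable_mul_continuous hγc huc)).sub hgloc)
        fun x => ⟨δ x, hδ x, V x, D' x, hV x, hv x, ?_⟩
    filter_upwards [hae x] with y hy hyI
    rw [(hy hyI).2.2, hu x y hyI, hv x y hyI]
  · refine measure_null_of_locally_null _ fun x _ => ?_
    refine ⟨Ioo (x - δ x) (x + δ x) ∩ {t | ¬ f t = U t t}, ?_, ?_⟩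
    · rw [inter_comm]
      exact inter_mem_nhdsWithin _ (Ioo_mem_nhds (hself x).1 (hself x).2)
    · refine measure_mono_null ?_ (hae x)
      rintro y ⟨hyI, hy⟩ h
      exact hy ((h hyI).1.trans (hu x y hyI).symm)

end Regularity

section Energy

open scoped ComplexConjugate Topology

variable {α γ : ℝ → ℝ} {β : ℝ → ℂ}

theorem exists_forall_abs_le_of_isCompact {K : Set ℝ} (hK : IsCompact K) :
    ∃ R, 0 < R ∧ ∀ x ∈ K, |x| ≤ R := by
  obtain ⟨R, hR⟩ := hK.isBounded.exists_norm_le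
  exact ⟨max R 1, by positivity, fun x hx => (hR x hx).trans (le_max_left _ _)⟩

/-- If the first component of a solution vanishes almost everywhere on an open set, then both
components vanish there. -/
theorem IsSolution.eq_zero_of_ae {g u v : ℝ → ℂ} (h : IsSolution α β γ g u v)
    (hα0 : ∀ᵐ x, α x ≠ 0) {s : Set ℝ} (hs : IsOpen s) (hu : ∀ᵐ x, x ∈ s → u x = 0) :
    (∀ x ∈ s, u x = 0) ∧ ∀ x ∈ s, v x = 0 := by
  have hu0 : EqOn u (fun _ => 0) s := Measure.eqOn_open_of_ae_eq (μ := volume)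
    ((ae_restrict_iff' hs.measurableSet).2 hu) hs h.fst.continuous.continuousOn continuousOn_const
  refine ⟨hu0, ?_⟩
  refine Measure.eqOn_open_of_ae_eq (μ := volume) (g := fun _ => 0)
    ((ae_restrict_iff' hs.measurableSet).2 ?_) hs h.snd.continuous.continuousOn continuousOn_const
  filter_upwards [hα0, h.fst.2] with x h0 hd hx
  have hd' : deriv u x = 0 := by
    rw [(hu0.eventuallyEq_of_mem (hs.mem_nhds hx)).deriv_eq]
    simp
  rw [hd.deriv, hu0 hx, mul_zero, add_zero] at hd'
  exact (mul_eq_zero.1 hd').resolve_left (Complex.ofReal_ne_zero.2 h0)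

/-- Green's formula in `L²` if one of the functions has compact support. -/
theorem inner_eq_inner_of_compactlySupported (hα0 : ∀ᵐ x, α x ≠ 0) {F G f g : L2}
    (hFG : IsPair α β γ F G) (hF : F ∈ compactlySupported) (hfg : IsPair α β γ f g) :
    inner ℂ G f = inner ℂ F g := by
  obtain ⟨u, v, huv, hu⟩ := hFG
  obtain ⟨w, z, hwz, hw⟩ := hfg
  obtain ⟨k, hk, hFk⟩ := hF
  obtain ⟨R, hR, hKR⟩ := exists_forall_abs_le_of_isCompact hk.isCompact
  obtain ⟨hu0, hv0⟩ := huv.eq_zero_of_ae hα0 (s := {x | R < |x|})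
    (isOpen_lt continuous_const continuous_abs) (by
      filter_upwards [hu, hFk] with x h1 h2 hx
      rw [← h1, h2]
      exact image_eq_zero_of_notMem_tsupport fun h => absurd (hKR x h) (not_le.2 hx))
  have i1 : Integrable (fun x => w x * conj (G x)) volume := by
    refine (L2.integrable_inner (𝕜 := ℂ) G f).congr ?_
    filter_upwards [hw] with x hx
    rw [RCLike.inner_apply, hx]
  have i2 : Integrable (fun x => g x * conj (u x)) volume := by
    refine (L2.integrable_inner (𝕜 := ℂ) F g).congr ?_
    filter_upwards [hu] with x hx
    rw [RCLike.inner_apply, hx]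
  rw [inner_eq_integral (EventuallyEq.refl _ _) hw, inner_eq_integral hu (EventuallyEq.refl _ _)]
  have hlim := intervalIntegral_tendsto_integral (i2.sub i1) tendsto_neg_atTop_atBot tendsto_id
  have h0 : ∀ᶠ r : ℝ in atTop,
      ∫ x in (-r)..id r, (g x * conj (u x) - w x * conj (G x)) = 0 := by
    filter_upwards [eventually_gt_atTop R] with r hr
    have hr1 : r ∈ {x | R < |x|} := hr.trans_le (le_abs_self r)
    have hr2 : -r ∈ {x | R < |x|} := by
      show R < |-r|
      rw [abs_neg]; exact hr1
    rw [(hwz.green huv).integral_eq, id, hu0 r hr1, hv0 r hr1, hu0 _ hr2, hv0 _ hr2]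
    simp
  have h1 := tendsto_nhds_unique hlim (tendsto_const_nhds.congr' (h0.mono fun _ h => h.symm))
  have h2 := integral_sub i2 i1
  simp only [Pi.sub_apply] at h1
  rw [h1] at h2
  exact (sub_eq_zero.1 h2.symm).symm

theorem integral_eq_intervalIntegral_of_support {E : Type*} [NormedAddCommGroup E]
    [NormedSpace ℝ E] {k : ℝ → E} {R : ℝ} (hR : 0 < R)
    (hk : ∀ x, R ≤ |x| → k x = 0) : ∫ x, k x = ∫ x in (-R)..R, k x := by
  rw [intervalIntegral.integral_of_le (by linarith),
    setIntegral_eq_integral_of_forall_compl_eq_zero]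
  intro x hx
  refine hk x ?_
  by_contra! h
  exact hx ⟨(abs_lt.1 h).1, (abs_lt.1 h).2.le⟩

/-- Multiplication of a solution by a cutoff function `φ` with `φ' = α ψ`. -/
theorem IsSolution.cutoff {g u v : ℝ → ℂ} (h : IsSolution α β γ g u v) {φ ψ : ℝ → ℝ}
    (hφ : ContDiff ℝ 1 φ) (hψ : ContDiff ℝ 1 ψ) (hφψ : ∀ x, deriv φ x = α x * ψ x) :
    IsSolution α β γ
      (fun x => φ x * g x - 2 * (α x * ψ x) * v x - (deriv ψ x : ℝ) * u x
        - (β x).re * (2 * (ψ x * u x)))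
      (fun x => φ x * u x) (fun x => φ x * v x + ψ x * u x) := by
  have hφ' := IsPrimitive.ofReal_of_contDiff hφ
  have hψ' := IsPrimitive.ofReal_of_contDiff hψ
  constructor
  · refine (hφ'.mul h.fst).congr (Eventually.of_forall fun x => ?_)
    simp only [hφψ]
    push_cast
    ring
  · refine ((hφ'.mul h.snd).add (hψ'.mul h.fst)).congr (Eventually.of_forall fun x => ?_)
    have hre : ((β x).re : ℂ) = (β x + conj (β x)) / 2 := by
      rw [Complex.add_conj]; push_cast; ring
    simp only [hφψ, hre]
    push_cast
    ring

theorem memLp_mul_of_memL2Loc {k : ℝ → ℝ} {y : ℝ → ℂ} (hk : MemL2Loc k) (hy : Continuous y)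
    (hys : HasCompactSupport y) : MemLp (fun x => (k x : ℂ) * y x) 2 volume := by
  obtain ⟨C, hC⟩ := hy.bounded_above_of_compact_support hys
  have hK : IsCompact (tsupport y) := hys
  have hkK : MemLp ((tsupport y).indicator k) 2 volume :=
    (memLp_indicator_iff_restrict hK.measurableSet).2 (hk _ hK)
  have hmeas : AEStronglyMeasurable (fun x => (k x : ℂ) * y x) volume := by
    have h1 : (fun x => (k x : ℂ) * y x) =
        fun x => (((tsupport y).indicator k x : ℝ) : ℂ) * y x := by
      ext x
      by_cases hx : x ∈ tsupport y
      · rw [indicator_of_mem hx]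
      · simp [image_eq_zero_of_notMem_tsupport hx]
    rw [h1]
    exact (Complex.continuous_ofReal.comp_aestronglyMeasurable hkK.1).mul hy.aestronglyMeasurable
  refine MemLp.of_le_mul (c := C) hkK hmeas (Eventually.of_forall fun x => ?_)
  by_cases hx : x ∈ tsupport y
  · rw [indicator_of_mem hx, norm_mul, Complex.norm_real, mul_comm]
    exact mul_le_mul_of_nonneg_right (hC x) (norm_nonneg _)
  · simp [image_eq_zero_of_notMem_tsupport hx, hx]

/-- The energy estimate for eigenfunctions below the lower bound of the quadratic form. -/
theorem energy_estimate (hα : Continuous α) (hβ : MemL2Loc fun x => (β x).re) {c μ : ℝ}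
    (hbdd : ∀ F G : L2, IsPair α β γ F G → F ∈ compactlySupported →
      c * ‖F‖ ^ 2 ≤ (inner ℂ G F).re)
    {u v : ℝ → ℂ} (huv : IsSolution α β γ (fun x => μ * u x) u v) {φ ψ : ℝ → ℝ}
    (hφ : ContDiff ℝ 1 φ) (hψ : ContDiff ℝ 1 ψ) (hφs : HasCompactSupport φ)
    (hψs : HasCompactSupport ψ) (hφψ : ∀ x, deriv φ x = α x * ψ x) :
    (c - μ) * ∫ x, φ x ^ 2 * ‖u x‖ ^ 2 ≤ ∫ x, α x * ψ x ^ 2 * ‖u x‖ ^ 2 := by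
  have hu := huv.fst.continuous
  have hv := huv.snd.continuous
  have hsol := huv.cutoff hφ hψ hφψ
  set w : ℝ → ℂ := fun x => φ x * u x with hw
  set G : ℝ → ℂ := fun x => φ x * (μ * u x) - 2 * (α x * ψ x) * v x - (deriv ψ x : ℝ) * u x
        - (β x).re * (2 * (ψ x * u x)) with hG
  have hφc := hφ.continuous
  have hψc := hψ.continuous
  have hψ'c : Continuous (deriv ψ) := hψ.continuous_deriv (by norm_num)
  obtain ⟨R, hR, hRφ⟩ := exists_forall_abs_le_of_isCompact hφs.isCompact
  obtain ⟨S, hS, hSψ⟩ := exists_forall_abs_le_of_isCompact hψs.isCompact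
  obtain ⟨N, hN, hRN, hSN⟩ : ∃ N, 0 < N ∧ R < N ∧ S < N :=
    ⟨R + S, by linarith, by linarith, by linarith⟩
  have φ0 : ∀ x, N ≤ |x| → φ x = 0 := fun x hx => image_eq_zero_of_notMem_tsupport fun h =>
    absurd (hRφ x h) (by linarith)
  have ψ0 : ∀ x, N ≤ |x| → ψ x = 0 := fun x hx => image_eq_zero_of_notMem_tsupport fun h =>
    absurd (hSψ x h) (by linarith)
  have ψ'0 : ∀ x, N ≤ |x| → deriv ψ x = 0 := fun x hx =>
    image_eq_zero_of_notMem_tsupport fun h =>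
      absurd (hSψ x (closure_minimal support_deriv_subset (isClosed_tsupport ψ) h)) (by linarith)
  have hcs : ∀ k : ℝ → ℂ, (∀ x, N ≤ |x| → k x = 0) → HasCompactSupport k := fun k hk =>
    HasCompactSupport.intro (isCompact_Icc (a := -N) (b := N)) fun x hx => hk x (by
      by_contra! h
      exact hx ⟨(abs_lt.1 h).1.le, (abs_lt.1 h).2.le⟩)
  have hwc : Continuous w := by fun_prop
  have hws : HasCompactSupport w := hcs w fun x hx => by simp [hw, φ0 x hx]
  have hwL : MemLp w 2 volume := hwc.memLp_of_hasCompactSupport hws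
  have hGL : MemLp G 2 volume := by
    refine MemLp.sub (Continuous.memLp_of_hasCompactSupport (by fun_prop) (hcs _ fun x hx => ?_))
      (memLp_mul_of_memL2Loc hβ (by fun_prop) (hcs _ fun x hx => ?_))
    · simp [φ0 x hx, ψ0 x hx, ψ'0 x hx]
    · simp [ψ0 x hx]
  have aew : hwL.toLp =ᵐ[volume] w := MemLp.coeFn_toLp _
  have aeG : hGL.toLp =ᵐ[volume] G := MemLp.coeFn_toLp _
  have hpair : IsPair α β γ hwL.toLp hGL.toLp :=
    ⟨w, _, ⟨hsol.fst, hsol.snd.congr (aeG.mono fun x hx => congrArg (_ - ·) hx.symm)⟩, aew⟩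
  have hlow := hbdd _ _ hpair ⟨w, hws, aew⟩
  have hnorm : ‖hwL.toLp‖ ^ 2 = ∫ x, φ x ^ 2 * ‖u x‖ ^ 2 := by
    have h1 : ((‖hwL.toLp‖ ^ 2 : ℝ) : ℂ) = ((∫ x, φ x ^ 2 * ‖u x‖ ^ 2 : ℝ) : ℂ) := by
      have h2 := inner_self_eq_norm_sq_to_K (𝕜 := ℂ) hwL.toLp
      rw [inner_eq_integral aew aew] at h2
      push_cast
      rw [← integral_complex_ofReal]
      refine h2.symm.trans (integral_congr_ae (Eventually.of_forall fun x => ?_))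
      simp only [hw, Complex.mul_conj, Complex.normSq_eq_norm_sq, norm_mul, Complex.norm_real,
        Real.norm_eq_abs, mul_pow, sq_abs]
    exact_mod_cast h1
  obtain ⟨D, hprim, hD⟩ : ∃ D, IsPrimitive (fun x => (φ x : ℂ) * ψ x * (u x * conj (u x))) D ∧
      ∀ x, (w x * conj (G x)).re + (D x).re
        = μ * (φ x ^ 2 * ‖u x‖ ^ 2) + α x * ψ x ^ 2 * ‖u x‖ ^ 2 := by
    refine ⟨_, ((IsPrimitive.ofReal_of_contDiff hφ).mul
      (IsPrimitive.ofReal_of_contDiff hψ)).mul (huv.fst.mul huv.fst.conjugate), fun x => ?_⟩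
    simp only [hw, hG, hφψ, Complex.sq_norm, Complex.normSq_apply, Complex.mul_re, Complex.mul_im,
      Complex.add_re, Complex.add_im, Complex.sub_re, Complex.sub_im, Complex.conj_re,
      Complex.conj_im, Complex.ofReal_re, Complex.ofReal_im, Complex.re_ofNat, Complex.im_ofNat]
    ring
  have hNabs : N ≤ |N| := le_abs_self N
  have hNabs' : N ≤ |-N| := by rw [abs_neg]; exact hNabs
  have hD0 : ∫ x in (-N)..N, (D x).re = 0 := by
    have h1 := Complex.reCLM.intervalIntegral_comp_comm (hprim.intervalIntegrable (-N) N)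
    rw [hprim.integral_eq, φ0 N hNabs, φ0 (-N) hNabs'] at h1
    simpa using h1
  have iD : IntervalIntegrable (fun x => (D x).re) volume (-N) N :=
    ⟨(hprim.intervalIntegrable (-N) N).1.re, (hprim.intervalIntegrable (-N) N).2.re⟩
  have ik : Integrable (fun x => w x * conj (G x)) volume := by
    refine (L2.integrable_inner (𝕜 := ℂ) hGL.toLp hwL.toLp).congr ?_
    filter_upwards [aew, aeG] with x h1 h2
    rw [RCLike.inner_apply, h1, h2]
  have ikr : IntervalIntegrable (fun x => (w x * conj (G x)).re) volume (-N) N :=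
    ik.re.intervalIntegrable
  have hre : (inner ℂ hGL.toLp hwL.toLp).re = ∫ x in (-N)..N, (w x * conj (G x)).re := by
    rw [inner_eq_integral aeG aew, integral_eq_intervalIntegral_of_support hN
      fun x hx => by simp [hw, φ0 x hx]]
    exact (Complex.reCLM.intervalIntegral_comp_comm ik.intervalIntegrable).symm
  have hsum : (inner ℂ hGL.toLp hwL.toLp).re
      = μ * (∫ x, φ x ^ 2 * ‖u x‖ ^ 2) + ∫ x, α x * ψ x ^ 2 * ‖u x‖ ^ 2 := by
    rw [integral_eq_intervalIntegral_of_support hN (k := fun x => φ x ^ 2 * ‖u x‖ ^ 2)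
        fun x hx => by simp [φ0 x hx],
      integral_eq_intervalIntegral_of_support hN (k := fun x => α x * ψ x ^ 2 * ‖u x‖ ^ 2)
        fun x hx => by simp [ψ0 x hx], ← intervalIntegral.integral_const_mul,
      ← intervalIntegral.integral_add (Continuous.intervalIntegrable (by fun_prop) _ _)
        (Continuous.intervalIntegrable (by fun_prop) _ _), hre, ← add_zero (∫ x in _.._, _),
      ← hD0, ← intervalIntegral.integral_add ikr iD]
    exact intervalIntegral.integral_congr fun x _ => hD x
  rw [hnorm, hsum] at hlow
  linarith

/-- There is no square integrable eigenfunction below the lower bound of the quadratic form if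
there are suitable cutoff functions. -/
theorem eq_zero_of_isPair_smul (hα : Continuous α) (hα0 : ∀ x, 0 ≤ α x)
    (hβ : MemL2Loc fun x => (β x).re) {c μ : ℝ} (hμ : μ < c)
    (hbdd : ∀ F G : L2, IsPair α β γ F G → F ∈ compactlySupported →
      c * ‖F‖ ^ 2 ≤ (inner ℂ G F).re)
    (hcut : ∀ R ε : ℝ, 0 < ε → ∃ φ ψ : ℝ → ℝ, ContDiff ℝ 1 φ ∧ ContDiff ℝ 1 ψ ∧
      HasCompactSupport φ ∧ HasCompactSupport ψ ∧ (∀ x, deriv φ x = α x * ψ x) ∧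
      (∀ x, α x * ψ x ^ 2 ≤ ε) ∧ ∀ x ∈ Icc (-R) R, φ x = 1)
    {f : L2} (hf : IsPair α β γ f ((μ : ℂ) • f)) : f = 0 := by
  obtain ⟨u, v, huv, hfu⟩ := hf
  have huv' : IsSolution α β γ (fun x => μ * u x) u v := by
    refine ⟨huv.fst, huv.snd.congr ?_⟩
    filter_upwards [hfu, Lp.coeFn_smul (μ : ℂ) f] with x h1 h2
    rw [h2, Pi.smul_apply, h1, smul_eq_mul]
  have hint : Integrable (fun x => ‖u x‖ ^ 2) volume :=
    ((memLp_congr_ae hfu).1 (Lp.memLp f)).integrable_norm_pow (by norm_num)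
  have hnorm : ‖f‖ ^ 2 = ∫ x, ‖u x‖ ^ 2 := by
    have h1 : ((‖f‖ ^ 2 : ℝ) : ℂ) = ((∫ x, ‖u x‖ ^ 2 : ℝ) : ℂ) := by
      have h2 := inner_self_eq_norm_sq_to_K (𝕜 := ℂ) f
      rw [inner_eq_integral hfu hfu] at h2
      push_cast
      rw [← integral_complex_ofReal]
      refine h2.symm.trans (integral_congr_ae (Eventually.of_forall fun x => ?_))
      simp only [Complex.mul_conj, Complex.normSq_eq_norm_sq]
    exact_mod_cast h1
  have hu := huv.fst.continuous
  have hcμ : 0 < c - μ := sub_pos.2 hμ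
  have hbound : ∀ᶠ R : ℝ in atTop, ∫ x in (-R)..id R, ‖u x‖ ^ 2 ≤ (1 / 2) * ‖f‖ ^ 2 := by
    filter_upwards [eventually_ge_atTop 0] with R hR
    obtain ⟨φ, ψ, hφ, hψ, hφs, hψs, hφψ, hψε, hφ1⟩ := hcut R ((c - μ) / 2) (half_pos hcμ)
    have h1 := energy_estimate hα hβ hbdd huv' hφ hψ hφs hψs hφψ
    have hφc := hφ.continuous
    have hψc := hψ.continuous
    have h2 : ∫ x, α x * ψ x ^ 2 * ‖u x‖ ^ 2 ≤ ∫ x, (c - μ) / 2 * ‖u x‖ ^ 2 :=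
      integral_mono_of_nonneg
        (Eventually.of_forall fun x => mul_nonneg (mul_nonneg (hα0 x) (sq_nonneg _)) (sq_nonneg _))
        (hint.const_mul _)
        (Eventually.of_forall fun x => mul_le_mul_of_nonneg_right (hψε x) (sq_nonneg _))
    have h3 : ∫ x in (-R)..id R, ‖u x‖ ^ 2 ≤ ∫ x, φ x ^ 2 * ‖u x‖ ^ 2 := by
      have h4 : Integrable (fun x => φ x ^ 2 * ‖u x‖ ^ 2) volume := by
        refine Continuous.integrable_of_hasCompactSupport (by fun_prop) ?_
        exact HasCompactSupport.mul_right (hφs.comp_left (g := fun t => t ^ 2) (by simp))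
      rw [id, intervalIntegral.integral_of_le (by linarith)]
      refine le_trans (le_of_eq ?_) (setIntegral_le_integral (s := Ioc (-R) R) h4
        (Eventually.of_forall fun x => mul_nonneg (sq_nonneg _) (sq_nonneg _)))
      refine setIntegral_congr_fun measurableSet_Ioc fun x hx => ?_
      simp [hφ1 x (Ioc_subset_Icc_self hx)]
    rw [integral_const_mul, ← hnorm] at h2
    have h5 := mul_le_mul_of_nonneg_left h3 hcμ.le
    nlinarith
  have hlim := intervalIntegral_tendsto_integral hint tendsto_neg_atTop_atBot tendsto_id
  have h := le_of_tendsto hlim hbound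
  rw [← hnorm] at h
  have : ‖f‖ ^ 2 = 0 := le_antisymm (by linarith) (sq_nonneg _)
  exact norm_eq_zero.1 (pow_eq_zero_iff (two_ne_zero) |>.1 this)

end Energy

section Cutoff

open scoped Topology

theorem exists_lt_integral_of_lintegral_Ici_eq_top {k : ℝ → ℝ} (hk : Continuous k)
    (hk0 : ∀ x, 0 ≤ k x) (htop : ∫⁻ t in Ici (0 : ℝ), ENNReal.ofReal (k t) = ⊤) (M : ℝ) :
    ∃ x, 0 ≤ x ∧ M < ∫ t in (0 : ℝ)..x, k t := by
  by_contra! h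
  have hint : IntegrableOn k (Ioi 0) volume :=
    integrableOn_Ioi_of_intervalIntegral_norm_bounded M 0 (b := id) (l := atTop)
      (fun i => (hk.integrableOn_Icc).mono_set Ioc_subset_Icc_self) tendsto_id (by
        filter_upwards [eventually_ge_atTop 0] with x hx
        simpa [Real.norm_eq_abs, abs_of_nonneg (hk0 _)] using h x hx)
  rw [setLIntegral_congr Ioi_ae_eq_Ici.symm,
    ← ofReal_integral_eq_lintegral_ofReal hint (Eventually.of_forall hk0)] at htop
  exact ENNReal.ofReal_ne_top htop

theorem exists_integral_lt_of_lintegral_Iic_eq_top {k : ℝ → ℝ} (hk : Continuous k)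
    (hk0 : ∀ x, 0 ≤ k x) (htop : ∫⁻ t in Iic (0 : ℝ), ENNReal.ofReal (k t) = ⊤) (M : ℝ) :
    ∃ x, x ≤ 0 ∧ ∫ t in (0 : ℝ)..x, k t < -M := by
  by_contra! h
  have hint : IntegrableOn k (Iic 0) volume :=
    integrableOn_Iic_of_intervalIntegral_norm_bounded M 0 (a := id) (l := atBot)
      (fun i => (hk.integrableOn_Icc).mono_set Ioc_subset_Icc_self) tendsto_id (by
        filter_upwards [eventually_le_atBot 0] with x hx
        have := h x hx
        rw [intervalIntegral.integral_symm] at this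
        simpa [Real.norm_eq_abs, abs_of_nonneg (hk0 _)] using neg_le_neg this)
  rw [← ofReal_integral_eq_lintegral_ofReal hint (Eventually.of_forall hk0)] at htop
  exact ENNReal.ofReal_ne_top htop

/-- Cutoff functions `φ` with `φ' = ψ / p` and small energy density `ψ² / p`, equal to one on
a given interval. -/
theorem exists_cutoff {p : ℝ → ℝ} (hp : Continuous p) (hpos : ∀ x, 0 < p x)
    (hleft : ∫⁻ t in Iic (0 : ℝ), ENNReal.ofReal (p t ^ (-(1 / 2) : ℝ)) = ⊤)
    (hright : ∫⁻ t in Ici (0 : ℝ), ENNReal.ofReal (p t ^ (-(1 / 2) : ℝ)) = ⊤)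
    (R ε : ℝ) (hε : 0 < ε) :
    ∃ φ ψ : ℝ → ℝ, ContDiff ℝ 1 φ ∧ ContDiff ℝ 1 ψ ∧
      HasCompactSupport φ ∧ HasCompactSupport ψ ∧ (∀ x, deriv φ x = (p x)⁻¹ * ψ x) ∧
      (∀ x, (p x)⁻¹ * ψ x ^ 2 ≤ ε) ∧ ∀ x ∈ Icc (-R) R, φ x = 1 := by
  have hsq : Continuous fun x => √(p x) := hp.sqrt
  have hsq0 : ∀ x, 0 < √(p x) := fun x => Real.sqrt_pos.2 (hpos x)
  obtain ⟨ρ, hρ, hρd, -⟩ := Continuous.exists_contDiff_approx 1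
    (f := fun x => 3 / 4 * √(p x)) (ε := fun x => √(p x) / 4) (by fun_prop) (by fun_prop)
    (fun x => by have := hsq0 x; positivity)
  have hρ1 : ∀ x, √(p x) / 2 < ρ x ∧ ρ x < √(p x) := fun x => by
    have := hρd x
    rw [Real.dist_eq, abs_lt] at this
    constructor <;> linarith [this.1, this.2]
  have hρpos : ∀ x, 0 < ρ x := fun x => (half_pos (hsq0 x)).trans (hρ1 x).1
  have hρ' : ContDiff ℝ 1 ρ := by exact_mod_cast hρ
  set k : ℝ → ℝ := fun x => (p x)⁻¹ * ρ x with hk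
  have hkc : Continuous k := (hp.inv₀ fun x => (hpos x).ne').mul hρ'.continuous
  have hk0 : ∀ x, 0 ≤ k x := fun x => mul_nonneg (inv_nonneg.2 (hpos x).le) (hρpos x).le
  have hkp : ∀ x, p x ^ (-(1 / 2) : ℝ) ≤ 2 * k x := fun x => by
    rw [Real.rpow_neg (hpos x).le, ← Real.sqrt_eq_rpow]
    have h1 : (√(p x))⁻¹ = (p x)⁻¹ * √(p x) := by
      have h2 := Real.mul_self_sqrt (hpos x).le
      have h3 := (hsq0 x).ne'
      have h4 := (hpos x).ne'
      field_simp
      rw [sq, h2]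
    rw [h1, hk]
    have := mul_le_mul_of_nonneg_left (hρ1 x).1.le (inv_nonneg.2 (hpos x).le)
    simp only
    linarith
  have htop : ∀ s : Set ℝ, ∫⁻ t in s, ENNReal.ofReal (p t ^ (-(1 / 2) : ℝ)) = ⊤ →
      ∫⁻ t in s, ENNReal.ofReal (k t) = ⊤ := by
    intro s hs
    have h1 : ∫⁻ t in s, ENNReal.ofReal (p t ^ (-(1 / 2) : ℝ))
        ≤ ENNReal.ofReal 2 * ∫⁻ t in s, ENNReal.ofReal (k t) := by
      rw [← lintegral_const_mul _ hkc.measurable.ennreal_ofReal]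
      refine lintegral_mono fun t => ?_
      rw [← ENNReal.ofReal_mul two_pos.le]
      exact ENNReal.ofReal_le_ofReal (hkp t)
    rw [hs, top_le_iff, ENNReal.mul_eq_top] at h1
    rcases h1 with h1 | h1
    · exact h1.2
    · exact absurd h1.1 ENNReal.ofReal_ne_top
  set P : ℝ → ℝ := fun x => ∫ t in (0 : ℝ)..x, k t with hP
  have hPd : ∀ x, HasDerivAt P (k x) x := fun x =>
    intervalIntegral.integral_hasDerivAt_right (hkc.intervalIntegrable _ _)
      (hkc.stronglyMeasurableAtFilter _ _) hkc.continuousAt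
  have hPmono : Monotone P := monotone_of_hasDerivAt_nonneg hPd hk0
  have hPderiv : deriv P = k := funext fun x => (hPd x).deriv
  have hPC1 : ContDiff ℝ 1 P := by
    rw [contDiff_one_iff_deriv, hPderiv]
    exact ⟨fun x => (hPd x).differentiableAt, hkc⟩
  let χ : ContDiffBump (0 : ℝ) := ⟨1, 2, one_pos, one_lt_two⟩
  have hχ : ContDiff ℝ 2 χ := χ.contDiff
  have hχ' : ContDiff ℝ 1 (deriv χ) := by
    have h2 : ContDiff ℝ (1 + 1) χ := by exact_mod_cast hχ
    exact (contDiff_succ_iff_deriv.1 h2).2.2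
  obtain ⟨C, hC⟩ := hχ'.continuous.bounded_above_of_compact_support χ.hasCompactSupport.deriv
  have hC0 : 0 ≤ C := (norm_nonneg _).trans (hC 0)
  have hχ0 : ∀ x : ℝ, 2 < |x| → χ x = 0 := fun x hx =>
    χ.zero_of_le_dist (by rw [Real.dist_eq, sub_zero]; exact hx.le)
  have hχ'0 : ∀ x : ℝ, 2 < |x| → deriv χ x = 0 := fun x hx => by
    have : (χ : ℝ → ℝ) =ᶠ[𝓝 x] fun _ => 0 := by
      filter_upwards [(isOpen_lt continuous_const continuous_abs).mem_nhds hx] with y hy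
      exact hχ0 y hy
    rw [this.deriv_eq]
    simp
  obtain ⟨B, hB⟩ := isCompact_Icc.exists_bound_of_continuousOn (s := Icc (-R) R)
    hPC1.continuous.continuousOn
  obtain ⟨N, hN, hBN, hCN⟩ : ∃ N : ℝ, 0 < N ∧ B ≤ N ∧ C ^ 2 ≤ ε * N ^ 2 := by
    refine ⟨max 1 (max B (C / √ε)), by positivity, by simp, ?_⟩
    set N := max 1 (max B (C / √ε))
    have h1 : C / √ε ≤ N := (le_max_right _ _).trans (le_max_right _ _)
    have h2 : C ≤ N * √ε := (div_le_iff₀ (Real.sqrt_pos.2 hε)).1 h1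
    calc C ^ 2 ≤ (N * √ε) ^ 2 := pow_le_pow_left₀ hC0 h2 2
      _ = ε * N ^ 2 := by rw [mul_pow, Real.sq_sqrt hε.le, mul_comm]
  obtain ⟨b, hb0, hb⟩ := exists_lt_integral_of_lintegral_Ici_eq_top hkc hk0 (htop _ hright) (2 * N)
  obtain ⟨a, ha0, ha⟩ := exists_integral_lt_of_lintegral_Iic_eq_top hkc hk0 (htop _ hleft) (2 * N)
  have hout : ∀ x ∉ Icc a b, 2 < |P x / N| := by
    intro x hx
    rw [abs_div, abs_of_pos hN, lt_div_iff₀ hN]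
    rcases lt_or_ge x a with h | h
    · have := hPmono h.le
      rw [abs_of_neg] <;> simp only [hP] at * <;> linarith
    · have h' : b < x := by
        by_contra! hxb
        exact hx ⟨h, hxb⟩
      have := hPmono h'.le
      rw [abs_of_pos] <;> simp only [hP] at * <;> linarith
  refine ⟨fun x => χ (P x / N), fun x => deriv χ (P x / N) * (ρ x / N),
    (hχ.of_le one_le_two).comp (hPC1.div_const N),
    (hχ'.comp (hPC1.div_const N)).mul (hρ'.div_const N),
    HasCompactSupport.intro (isCompact_Icc (a := a) (b := b)) fun x hx => hχ0 _ (hout x hx),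
    HasCompactSupport.intro (isCompact_Icc (a := a) (b := b)) fun x hx => by
      rw [hχ'0 _ (hout x hx), zero_mul], fun x => ?_, fun x => ?_, fun x hx => ?_⟩
  · have h1 : HasDerivAt (χ : ℝ → ℝ) (deriv χ (P x / N)) (P x / N) :=
      ((hχ.differentiable (by norm_num)).differentiableAt).hasDerivAt
    refine (h1.comp x ((hPd x).div_const N)).deriv.trans ?_
    simp only [hk]
    ring
  · have h1 : (p x)⁻¹ * ρ x ^ 2 ≤ 1 := by
      rw [inv_mul_le_iff₀ (hpos x), mul_one, ← Real.sq_sqrt (hpos x).le]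
      exact pow_le_pow_left₀ (hρpos x).le (hρ1 x).2.le 2
    have h2 : deriv χ (P x / N) ^ 2 ≤ C ^ 2 := by
      rw [← sq_abs]
      exact pow_le_pow_left₀ (abs_nonneg _) (hC _) 2
    have h3 : (p x)⁻¹ * (deriv χ (P x / N) * (ρ x / N)) ^ 2
        = ((p x)⁻¹ * ρ x ^ 2) * (deriv χ (P x / N) ^ 2 / N ^ 2) := by
      field_simp
    rw [h3]
    calc ((p x)⁻¹ * ρ x ^ 2) * (deriv χ (P x / N) ^ 2 / N ^ 2)
        ≤ 1 * (C ^ 2 / N ^ 2) := by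
          refine mul_le_mul h1 ?_ (by positivity) one_pos.le
          gcongr
      _ ≤ ε := by
          rw [one_mul, div_le_iff₀ (by positivity)]
          exact hCN
  · refine χ.one_of_mem_closedBall ?_
    rw [Metric.mem_closedBall, Real.dist_eq, sub_zero, abs_div, abs_of_pos hN, div_le_iff₀ hN]
    have := hB x hx
    rw [Real.norm_eq_abs] at this
    change |P x| ≤ 1 * N
    linarith

end Cutoff

section Coefficients

open scoped ComplexConjugate

variable {p p₀ Q r s : ℝ → ℝ}

theorem memL2Loc_mul_continuous {k y : ℝ → ℝ} (hk : MemL2Loc k) (hy : Continuous y) :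
    MemL2Loc fun x => k x * y x := by
  intro K hK
  obtain ⟨C, hC⟩ := hK.exists_bound_of_continuousOn hy.continuousOn
  refine MemLp.of_le_mul (c := C) (hk K hK) ((hk K hK).1.mul hy.aestronglyMeasurable) ?_
  filter_upwards [ae_restrict_mem hK.measurableSet] with x hx
  rw [norm_mul, mul_comm]
  exact mul_le_mul_of_nonneg_right (hC x hx) (norm_nonneg _)

theorem MemL2Loc.congr_ae {k y : ℝ → ℝ} (hk : MemL2Loc k) (h : k =ᵐ[volume] y) : MemL2Loc y :=
  fun K hK => (memLp_congr_ae (ae_restrict_of_ae h)).1 (hk K hK)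

theorem MemL2Loc.locallyIntegrable {k : ℝ → ℝ} (hk : MemL2Loc k) : LocallyIntegrable k volume := by
  rw [locallyIntegrable_iff]
  intro K hK
  have : IsFiniteMeasure (volume.restrict K) := ⟨by simpa using hK.measure_lt_top⟩
  exact (hk K hK).integrable (by norm_num)

theorem MemL2Loc.locallyIntegrable_sq {k : ℝ → ℝ} (hk : MemL2Loc k) :
    LocallyIntegrable (fun x => k x ^ 2) volume := by
  rw [locallyIntegrable_iff]
  exact fun K hK => (hk K hK).integrable_sq

/-- `k / p ∈ L²_loc` if `k / √|p| ∈ L²_loc` and `p` is continuous and positive. -/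
theorem memL2Loc_div {k : ℝ → ℝ} (hk : MemL2Loc fun x => k x / √|p x|) (hp₀ : Continuous p₀)
    (hpp : p =ᵐ[volume] p₀) (hpos : ∀ x, 0 < p₀ x) : MemL2Loc fun x => k x / p₀ x := by
  have hc : Continuous fun x => (√(p₀ x))⁻¹ :=
    hp₀.sqrt.inv₀ fun x => (Real.sqrt_pos.2 (hpos x)).ne'
  refine (memL2Loc_mul_continuous hk hc).congr_ae ?_
  filter_upwards [hpp] with x hx
  rw [hx, abs_of_pos (hpos x), ← div_eq_mul_inv, div_div, Real.mul_self_sqrt (hpos x).le]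

theorem locallyIntegrable_sq_div {k : ℝ → ℝ} (hk : MemL2Loc fun x => k x / √|p x|)
    (hpp : p =ᵐ[volume] p₀) (hpos : ∀ x, 0 < p₀ x) :
    LocallyIntegrable (fun x => k x ^ 2 / p₀ x) volume := by
  refine hk.locallyIntegrable_sq.congr ?_
  filter_upwards [hpp] with x hx
  rw [hx, abs_of_pos (hpos x), div_pow, Real.sq_sqrt (hpos x).le]

/-- The quasi-differential expression as a first order system. -/
theorem isMaximalPair_iff_isPair (hpp : p =ᵐ[volume] p₀) (hpos : ∀ x, 0 < p₀ x) (f g : L2) :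
    IsMaximalPair p Q r s f g ↔
      IsPair (fun x => (p₀ x)⁻¹)
        (fun x => ((Q x / p₀ x : ℝ) : ℂ) + ((r x / p₀ x : ℝ) : ℂ) * Complex.I)
        (fun x => Q x ^ 2 / p₀ x + r x ^ 2 / p₀ x - s x) f g := by
  have hne : ∀ x, (p₀ x : ℂ) ≠ 0 := fun x => Complex.ofReal_ne_zero.2 (hpos x).ne'
  constructor
  · rintro ⟨u, v, hu, hv, hf, h1, h2⟩
    refine ⟨u, v, ⟨hu.isPrimitive.congr ?_, hv.isPrimitive.congr ?_⟩, hf⟩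
    · filter_upwards [h1, hpp] with x e hx
      have := hne x
      rw [e, quasiDeriv₁, hx]
      push_cast
      field_simp
      ring
    · filter_upwards [h2, hpp] with x e hx
      have := hne x
      rw [e, quasiDeriv₂, hx]
      simp only [map_add, map_mul, Complex.conj_ofReal, Complex.conj_I]
      push_cast
      field_simp
      ring
  · rintro ⟨u, v, ⟨hu, hv⟩, hf⟩
    refine ⟨u, v, hu.1, hv.1, hf, ?_, ?_⟩
    · filter_upwards [hu.deriv_ae, hpp] with x e hx
      have := hne x
      rw [quasiDeriv₁, e, hx]
      push_cast
      field_simp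
      ring
    · filter_upwards [hv.deriv_ae, hpp] with x e hx
      have := hne x
      rw [quasiDeriv₂, e, hx]
      simp only [map_add, map_mul, Complex.conj_ofReal, Complex.conj_I]
      push_cast
      field_simp
      ring

theorem mem_graph_preminimalOp (f g : L2) :
    (f, g) ∈ (preminimalOp p Q r s).graph ↔
      IsMaximalPair p Q r s f g ∧ f ∈ compactlySupported := by
  rw [← mem_graph_maximalOp, preminimalOp]
  constructor
  · intro h
    obtain ⟨y, rfl, rfl⟩ := (LinearPMap.mem_graph_iff _).1 h
    exact ⟨LinearPMap.le_graph_of_le LinearPMap.domRestrict_le h, y.2.1⟩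
  · rintro ⟨h, hf⟩
    obtain ⟨y, rfl, rfl⟩ := (LinearPMap.mem_graph_iff _).1 h
    exact (LinearPMap.mem_graph_iff _).2 ⟨⟨y, hf, y.2⟩, rfl, LinearPMap.domRestrict_apply rfl⟩

/-- Essential self-adjointness of the semibounded preminimal operator; the leading coefficient only
has to be continuous and positive. -/
theorem preminimalOp_essentiallySelfAdjoint (hcoeff : CoeffConditions p Q r s)
    (hp₀ : Continuous p₀) (hpp : p =ᵐ[volume] p₀) (hpos : ∀ x, 0 < p₀ x)
    (hleft : ∫⁻ t in Iic (0 : ℝ), ENNReal.ofReal (p t ^ (-(1 / 2) : ℝ)) = ⊤)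
    (hright : ∫⁻ t in Ici (0 : ℝ), ENNReal.ofReal (p t ^ (-(1 / 2) : ℝ)) = ⊤)
    (hbdd : BoundedBelow (preminimalOp p Q r s)) :
    EssentiallySelfAdjoint (preminimalOp p Q r s) ∧
      (preminimalOp p Q r s).adjoint = maximalOp p Q r s ∧
      maximalOp p Q r s = (maximalOp p Q r s).adjoint := by
  obtain ⟨c, hc⟩ := hbdd
  have hiff := isMaximalPair_iff_isPair (Q := Q) (r := r) (s := s) hpp hpos
  set α : ℝ → ℝ := fun x => (p₀ x)⁻¹
  set β : ℝ → ℂ := fun x => ((Q x / p₀ x : ℝ) : ℂ) + ((r x / p₀ x : ℝ) : ℂ) * Complex.I with hβdef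
  set γ : ℝ → ℝ := fun x => Q x ^ 2 / p₀ x + r x ^ 2 / p₀ x - s x
  have hα : Continuous α := hp₀.inv₀ fun x => (hpos x).ne'
  have hα0 : ∀ x, 0 < α x := fun x => inv_pos.2 (hpos x)
  have hα0' : ∀ᵐ x, α x ≠ 0 := Eventually.of_forall fun x => (hα0 x).ne'
  have hQ := memL2Loc_div hcoeff.Q_div_sqrt hp₀ hpp hpos
  have hr := memL2Loc_div hcoeff.r_div_sqrt hp₀ hpp hpos
  have hβre : MemL2Loc fun x => (β x).re := by simpa [hβdef] using hQ
  have hβ : LocallyIntegrable β volume := by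
    rw [locallyIntegrable_iff]
    intro K hK
    exact ((locallyIntegrable_iff.1 hQ.locallyIntegrable K hK).ofReal).add
      (((locallyIntegrable_iff.1 hr.locallyIntegrable K hK).ofReal).mul_const _)
  have hγ : LocallyIntegrable γ volume :=
    ((locallyIntegrable_sq_div hcoeff.Q_div_sqrt hpp hpos).add
      (locallyIntegrable_sq_div hcoeff.r_div_sqrt hpp hpos)).sub hcoeff.s_loc
  have hbelow : ∀ F G : L2, IsPair α β γ F G → F ∈ SturmLiouville.compactlySupported →
      c * ‖F‖ ^ 2 ≤ (inner ℂ G F).re := by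
    intro F G hFG hF
    obtain ⟨y, rfl, rfl⟩ := (LinearPMap.mem_graph_iff _).1
      ((mem_graph_preminimalOp F G).2 ⟨(hiff F G).2 hFG, hF⟩)
    exact hc y
  have hadj : (maximalOp p Q r s).graph = (preminimalOp p Q r s).graph.adjoint := by
    ext ⟨f, g⟩
    rw [mem_graph_maximalOp, hiff, Submodule.mem_adjoint_iff]
    constructor
    · intro hfg F G hFG
      obtain ⟨h1, h2⟩ := (mem_graph_preminimalOp F G).1 hFG
      exact sub_eq_zero.2
        (inner_eq_inner_of_compactlySupported hα0' ((hiff F G).1 h1) h2 hfg)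
    · intro h
      exact isPair_of_weak hα.locallyIntegrable hβ hγ hα0' fun F G hFG hF =>
        sub_eq_zero.1 (h F G ((mem_graph_preminimalOp F G).2 ⟨(hiff F G).2 hFG, hF⟩))
  have hcongr : ∀ S : Set ℝ, ∫⁻ t in S, ENNReal.ofReal (p t ^ (-(1 / 2) : ℝ))
      = ∫⁻ t in S, ENNReal.ofReal (p₀ t ^ (-(1 / 2) : ℝ)) := fun S =>
    lintegral_congr_ae (ae_restrict_of_ae (hpp.mono fun x hx => by simp only [hx]))
  rw [hcongr] at hleft hright
  have hker : ∀ f : L2, (f, ((c - 1 : ℝ) : ℂ) • f) ∈ (maximalOp p Q r s).graph → f = 0 := by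
    intro f hf
    rw [mem_graph_maximalOp, hiff] at hf
    exact eq_zero_of_isPair_smul hα (fun x => (hα0 x).le) hβre (sub_one_lt c) hbelow
      (exists_cutoff hp₀ hpos hleft hright) hf
  obtain ⟨hd, hsymm, hclosable, hclos, hT, hL⟩ := essentiallySelfAdjoint_of_ker
    (T := preminimalOp p Q r s) (L := maximalOp p Q r s) LinearPMap.domRestrict_le (sub_one_lt c)
    hadj hc hker
  refine ⟨⟨hd, hsymm, hclosable, ?_⟩, hT, hL.symm⟩
  rw [hclos, LinearPMap.isSelfAdjoint_def]
  exact hL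

end Coefficients

end SturmLiouville

theorem theorem1 (p Q r s : ℝ → ℝ)
    (hcoeff : SturmLiouville.CoeffConditions p Q r s)
    (hp : SturmLiouville.MemW12Loc p)
    -- `p > 0`, for the continuous representative of `p`
    (hpos : ∃ p₀ : ℝ → ℝ, Continuous p₀ ∧ p =ᵐ[volume] p₀ ∧ ∀ x, 0 < p₀ x)
    (hleft : ∫⁻ t in Set.Iic (0 : ℝ), ENNReal.ofReal (p t ^ (-(1 / 2) : ℝ)) = ⊤)
    (hright : ∫⁻ t in Set.Ici (0 : ℝ), ENNReal.ofReal (p t ^ (-(1 / 2) : ℝ)) = ⊤)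
    (hbdd : SturmLiouville.BoundedBelow (SturmLiouville.preminimalOp p Q r s)) :
    SturmLiouville.EssentiallySelfAdjoint (SturmLiouville.preminimalOp p Q r s) ∧
      (SturmLiouville.preminimalOp p Q r s).adjoint = SturmLiouville.maximalOp p Q r s ∧
      SturmLiouville.maximalOp p Q r s = (SturmLiouville.maximalOp p Q r s).adjoint := by
  obtain ⟨p₀, hp₀, hpp, hp₀pos⟩ := hpos
  exact SturmLiouville.preminimalOp_essentiallySelfAdjoint hcoeff hp₀ hpp hp₀pos hleft hright hbdd
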